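/- Let $p$ be an odd prime and write $[x,y]=xyx^{-1}y^{-1}$. Let $H=\langle a,b,c,d\rangle$ be the group with generators $a,b,c,d$ defined by the requirement that $H$ has nilpotency class at most $2$ (all commutators are central) together with the relations $$a^p=[a,c],\qquad b^p=[a,bcd],\qquad c^p=[b,cd],\qquad d^p=[b,d].$$ Let $H'$ be the commutator subgroup of $H$ and $H^p=\langle h^p : h\in H\rangle$. Then $|H|=p^{10}$, and $\langle [a,b]\rangle$ and $\langle [a,d]\rangle$ are subgroups of order $p$ of $H'$ not contained in $H^p$. Let $M\le H'$ be any subgroup of order $p$ with $M\nsubseteq H^p$, and let $G_1$ be a central product of $H$ with a cyclic group $\langle z\rangle$ of order $p^2$, amalgamated over $M$; that is, $G_1$ is a group containing $H$ as a normal subgroup and an element $z$ of order $p^2$ such that $G_1=H\langle z\rangle$, $H\cap\langle z\rangle=M$, and $z$ centralizes $H$. Such groups $G_1$ exist. Every such $G_1$ is a finite $p$-group that is not special, i.e. the equalities $Z(G_1)=G_1'=\Phi(G_1)$ do not both hold, where $Z(G_1)$, $G_1'$ and $\Phi(G_1)$ denote the center, the commutator subgroup and the Frattini subgroup. Moreover,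 calling a group a Miller group if it is non-abelian and its automorphism group is abelian: 1. if $M=\langle [a,b]\rangle$, then $G_1$ is a Miller group; 2. if $M=\langle [a,d]\rangle$, then $G_1$ is not a Miller group. -/

import Mathlib

open scoped commutatorElement

/-- A Miller group: a non-abelian group whose automorphism group is abelian. -/
def IsMiller (G : Type*) [Group G] : Prop :=
  (∃ x y : G, x * y ≠ y * x) ∧ ∀ φ ψ : MulAut G, φ * ψ = ψ * φ

/-- A special `p`-group: a `p`-group whose center, commutator subgroup and Frattini subgroup
coincide. -/
def IsSpecial (p : ℕ) (G : Type*) [Group G] : Prop :=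
  IsPGroup p G ∧ Subgroup.center G = commutator G ∧ commutator G = frattini G

/-- The subgroup `G ^ p` generated by all `p`-th powers of elements of `G`. -/
def powerSubgroup (p : ℕ) (G : Type*) [Group G] : Subgroup G :=
  Subgroup.closure {x : G | ∃ g : G, g ^ p = x}

/-- `G` is the amalgamated internal semi-direct product of `H` by `K` over `M`. -/
structure IsAmalgamatedSemidirectProduct {G : Type*} [Group G] (H K M : Subgroup G) : Prop where
  normal : H.Normal
  mul_eq : ∀ g : G, ∃ h ∈ H, ∃ k ∈ K, h * k = g
  inf_eq : H ⊓ K = M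

/-- `G` is the central product of `H` by `K` over `M`: an amalgamated semi-direct product in which
`K` acts trivially on `H`. -/
structure IsAmalgamatedCentralProduct {G : Type*} [Group G] (H K M : Subgroup G) : Prop
    extends IsAmalgamatedSemidirectProduct H K M where
  comm : ∀ h ∈ H, ∀ k ∈ K, k * h * k⁻¹ = h

/-- The relators, in the free group on `a = 0`, `b = 1`, `c = 2`, `d = 3`, of the group of
nilpotency class 2 with `a ^ p = [a, c]`, `b ^ p = [a, bcd]`, `c ^ p = [b, cd]`, `d ^ p = [b, d]`.
Here `⁅x, y⁆ = x * y * x⁻¹ * y⁻¹`. -/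
inductive GroupHRel (p : ℕ) : FreeGroup (Fin 4) → Prop
  | class_two (x y z : FreeGroup (Fin 4)) : GroupHRel p ⁅⁅x, y⁆, z⁆
  | a_pow : GroupHRel p
      (FreeGroup.of (0 : Fin 4) ^ p * ⁅FreeGroup.of (0 : Fin 4), FreeGroup.of (2 : Fin 4)⁆⁻¹)
  | b_pow : GroupHRel p
      (FreeGroup.of (1 : Fin 4) ^ p *
        ⁅FreeGroup.of (0 : Fin 4), FreeGroup.of (1 : Fin 4) * FreeGroup.of (2 : Fin 4) * FreeGroup.of (3 : Fin 4)⁆⁻¹)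
  | c_pow : GroupHRel p
      (FreeGroup.of (2 : Fin 4) ^ p * ⁅FreeGroup.of (1 : Fin 4), FreeGroup.of (2 : Fin 4) * FreeGroup.of (3 : Fin 4)⁆⁻¹)
  | d_pow : GroupHRel p
      (FreeGroup.of (3 : Fin 4) ^ p * ⁅FreeGroup.of (1 : Fin 4), FreeGroup.of (3 : Fin 4)⁆⁻¹)

/-- The group `H`. -/
abbrev GroupH (p : ℕ) : Type := PresentedGroup {r | GroupHRel p r}

namespace GroupH

/-- The generator `a` of `H`. -/
def a (p : ℕ) : GroupH p := PresentedGroup.of 0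

/-- The generator `b` of `H`. -/
def b (p : ℕ) : GroupH p := PresentedGroup.of 1

/-- The generator `c` of `H`. -/
def c (p : ℕ) : GroupH p := PresentedGroup.of 2

/-- The generator `d` of `H`. -/
def d (p : ℕ) : GroupH p := PresentedGroup.of 3

end GroupH

/-- `M` is a subgroup of order `p` of `H'` that is not contained in `H ^ p`. -/
structure IsAmalgamationSubgroup (p : ℕ) (M : Subgroup (GroupH p)) : Prop where
  le_commutator : M ≤ commutator (GroupH p)
  card_eq : Nat.card M = p
  not_le_power : ¬ M ≤ powerSubgroup p (GroupH p)

/-- `G`, with the embedding `ι` of `H` and the element `z`, is the amalgamated product over `M` of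
`H` by the cyclic group `⟨z⟩` of order `p ^ 2`, where `z` acts trivially on `H`. -/
structure IsGroupG₁ (p : ℕ) (M : Subgroup (GroupH p)) {G : Type*} [Group G]
    (ι : GroupH p →* G) (z : G) : Prop where
  injective : Function.Injective ι
  orderOf_eq : orderOf z = p ^ 2
  product : IsAmalgamatedCentralProduct ι.range (Subgroup.zpowers z) (M.map ι)

/-!
Since commutators are central and of exponent `p`, and `p` is odd, the map `x ↦ x ^ p` induces a
linear map `P` from `V = H / H'`, of dimension 4 over `ZMod p`, to `H'`, which is the exterior square
of `V`. The map `P` is injective, and `[a, b]` and `[c, d]` span a complement of its image. This gives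
the explicit model `Model p` of `H` on `(ZMod (p ^ 2)) ^ 4 × (ZMod p) ^ 2`, in which commutators and
powers are polynomials in the coordinates (`Model.commutator_eq`, `Model.pow_p_eq`). The normal form
`exists_word_of_relations` shows that `H` is not larger than the model
(`GroupH.exists_equiv_model`).

In `G₁` choose `z` with `z ^ p = m`, a generator of `M`. Every element is `h * z ^ n`, with
`[h * z ^ i, k * z ^ j] = [h, k]` and `(h * z ^ n) ^ p = h ^ p * m ^ n`. Thus an automorphism of
`G₁` acts on `V = G₁ / Z(G₁)` by a matrix `g` that is compatible with `P` modulo the line `M`, and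
its exterior square preserves this line.

For `M = ⟨[a, b]⟩` these conditions are linear algebra over `ZMod p`, and they force `g = 1`
(`eq_standard_basis_of_wedge_relations`). Then every automorphism acts trivially modulo `G₁'`, and
such automorphisms commute because `G₁'` is central (`mulAut_mul_comm`). For `M = ⟨[a, d]⟩` the
matrix that sends `c` to `c + d` and fixes `a, b, d` satisfies the conditions; it lifts to an
automorphism that does not commute with a central one
(`Model.not_isMiller_of_isCentralProductWith`).

No `G₁` is special, since `z` is central but not in `G₁' ≤ H`.
-/

/-! ### A model of `H` -/

/-- A concrete copy of `H`. With `R = ZMod (p ^ 2)`, the element with coordinates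
`(x₁, x₂, x₃, x₄; s, t)` stands for `d ^ x₄ * c ^ x₃ * b ^ x₂ * a ^ x₁ * [a, b] ^ s * [c, d] ^ t`.

The `p`-th powers `a ^ p = [a, c]`, `b ^ p = [a, bcd]`, `c ^ p = [b, cd]`, `d ^ p = [b, d]` together
with `[a, b]` and `[c, d]` form a basis of `H'`, so `p R ^ 4` accounts for `H ^ p` and the
coordinates `s`, `t` for a complement of `H ^ p` in `H'`. Since a commutator contributes to `R ^ 4`
only through multiples of `p`, the multiplication is given by polynomials, and associativity is an
identity in a commutative ring in which `p * p = 0`. -/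
@[ext]
structure Model (p : ℕ) where
  x₁ : ZMod (p ^ 2)
  x₂ : ZMod (p ^ 2)
  x₃ : ZMod (p ^ 2)
  x₄ : ZMod (p ^ 2)
  s : ZMod p
  t : ZMod p

namespace Model

variable {p : ℕ}

/-- Reduction `ZMod (p ^ 2) → ZMod p`. -/
def red (p : ℕ) : ZMod (p ^ 2) →+* ZMod p :=
  ZMod.castHom (dvd_pow_self p two_ne_zero) (ZMod p)

theorem p_mul_p : (p : ZMod (p ^ 2)) * p = 0 := by
  have h := ZMod.natCast_self (p ^ 2)
  rw [Nat.cast_pow] at h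
  exact (pow_two _).symm.trans h

@[simp]
theorem red_p : red p (p : ZMod (p ^ 2)) = 0 := by
  rw [map_natCast, ZMod.natCast_self]

theorem p_mul_eq_zero_iff (hp : p.Prime) (x : ZMod (p ^ 2)) :
    (p : ZMod (p ^ 2)) * x = 0 ↔ red p x = 0 := by
  obtain ⟨n, rfl⟩ := ZMod.intCast_surjective x
  have h : (p : ZMod (p ^ 2)) * (n : ZMod (p ^ 2)) = ((p * n : ℤ) : ZMod (p ^ 2)) := by
    push_cast; rfl
  rw [map_intCast, h, ZMod.intCast_zmod_eq_zero_iff_dvd _ p,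
    ZMod.intCast_zmod_eq_zero_iff_dvd _ (p ^ 2), Nat.cast_pow, pow_two]
  exact mul_dvd_mul_iff_left (by exact_mod_cast hp.ne_zero)

theorem p_mul_inj (hp : p.Prime) {x y : ZMod (p ^ 2)} :
    (p : ZMod (p ^ 2)) * x = (p : ZMod (p ^ 2)) * y ↔ red p x = red p y := by
  rw [← sub_eq_zero, ← mul_sub, p_mul_eq_zero_iff hp, map_sub, sub_eq_zero]

theorem exists_eq_p_mul {x : ZMod (p ^ 2)} (hx : red p x = 0) :
    ∃ n : ℤ, x = ((p * n : ℤ) : ZMod (p ^ 2)) := by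
  obtain ⟨n, rfl⟩ := ZMod.intCast_surjective x
  rw [map_intCast, ZMod.intCast_zmod_eq_zero_iff_dvd] at hx
  obtain ⟨k, rfl⟩ := hx
  exact ⟨k, rfl⟩

instance : One (Model p) := ⟨⟨0, 0, 0, 0, 0, 0⟩⟩

-- The collection of the product of two normal forms: with `uᵢⱼ = gᵢ hⱼ` for `i < j`, the commutators
-- `[a, c]`, `[b, d]`, `[b, c] = c ^ p * d ^ (-p)` and `[a, d] = a ^ (-p) * b ^ p * [a, b]⁻¹` enter
-- with the exponents `u₁₃`, `u₂₄`, `u₂₃`, `u₁₄`.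
instance : Mul (Model p) where
  mul g h :=
    ⟨g.x₁ + h.x₁ + p * (g.x₁ * h.x₃ - g.x₁ * h.x₄),
     g.x₂ + h.x₂ + p * (g.x₁ * h.x₄),
     g.x₃ + h.x₃ + p * (g.x₂ * h.x₃),
     g.x₄ + h.x₄ + p * (g.x₂ * h.x₄ - g.x₂ * h.x₃),
     g.s + h.s + red p g.x₁ * (red p h.x₂ - red p h.x₄),
     g.t + h.t + red p g.x₃ * red p h.x₄⟩

instance : Inv (Model p) where
  inv g :=
    ⟨-g.x₁ + p * (g.x₁ * g.x₃ - g.x₁ * g.x₄),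
     -g.x₂ + p * (g.x₁ * g.x₄),
     -g.x₃ + p * (g.x₂ * g.x₃),
     -g.x₄ + p * (g.x₂ * g.x₄ - g.x₂ * g.x₃),
     -g.s + red p g.x₁ * (red p g.x₂ - red p g.x₄),
     -g.t + red p g.x₃ * red p g.x₄⟩

section Coordinates
variable (g h : Model p)

@[simp] theorem one_x₁ : (1 : Model p).x₁ = 0 := rfl
@[simp] theorem one_x₂ : (1 : Model p).x₂ = 0 := rfl
@[simp] theorem one_x₃ : (1 : Model p).x₃ = 0 := rfl
@[simp] theorem one_x₄ : (1 : Model p).x₄ = 0 := rfl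
@[simp] theorem one_s : (1 : Model p).s = 0 := rfl
@[simp] theorem one_t : (1 : Model p).t = 0 := rfl
@[simp] theorem mul_x₁ : (g * h).x₁ = g.x₁ + h.x₁ + p * (g.x₁ * h.x₃ - g.x₁ * h.x₄) := rfl
@[simp] theorem mul_x₂ : (g * h).x₂ = g.x₂ + h.x₂ + p * (g.x₁ * h.x₄) := rfl
@[simp] theorem mul_x₃ : (g * h).x₃ = g.x₃ + h.x₃ + p * (g.x₂ * h.x₃) := rfl
@[simp] theorem mul_x₄ : (g * h).x₄ = g.x₄ + h.x₄ + p * (g.x₂ * h.x₄ - g.x₂ * h.x₃) := rfl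
@[simp] theorem mul_s :
    (g * h).s = g.s + h.s + red p g.x₁ * (red p h.x₂ - red p h.x₄) := rfl
@[simp] theorem mul_t : (g * h).t = g.t + h.t + red p g.x₃ * red p h.x₄ := rfl
@[simp] theorem inv_x₁ : g⁻¹.x₁ = -g.x₁ + p * (g.x₁ * g.x₃ - g.x₁ * g.x₄) := rfl
@[simp] theorem inv_x₂ : g⁻¹.x₂ = -g.x₂ + p * (g.x₁ * g.x₄) := rfl
@[simp] theorem inv_x₃ : g⁻¹.x₃ = -g.x₃ + p * (g.x₂ * g.x₃) := rfl
@[simp] theorem inv_x₄ : g⁻¹.x₄ = -g.x₄ + p * (g.x₂ * g.x₄ - g.x₂ * g.x₃) := rfl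
@[simp] theorem inv_s : g⁻¹.s = -g.s + red p g.x₁ * (red p g.x₂ - red p g.x₄) := rfl
@[simp] theorem inv_t : g⁻¹.t = -g.t + red p g.x₃ * red p g.x₄ := rfl

end Coordinates

instance : Group (Model p) :=
  Group.ofLeftAxioms
    (fun g h k => by
      have h0 := p_mul_p (p := p)
      ext <;> simp <;> grind)
    (fun g => by ext <;> simp)
    (fun g => by
      have h0 := p_mul_p (p := p)
      ext <;> simp <;> grind)

theorem commutator_eq (g h : Model p) : ⁅g, h⁆ =
    ⟨p * ((g.x₁ * h.x₃ - g.x₃ * h.x₁) - (g.x₁ * h.x₄ - g.x₄ * h.x₁)),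
     p * (g.x₁ * h.x₄ - g.x₄ * h.x₁),
     p * (g.x₂ * h.x₃ - g.x₃ * h.x₂),
     p * ((g.x₂ * h.x₄ - g.x₄ * h.x₂) - (g.x₂ * h.x₃ - g.x₃ * h.x₂)),
     red p (g.x₁ * h.x₂ - g.x₂ * h.x₁) - red p (g.x₁ * h.x₄ - g.x₄ * h.x₁),
     red p (g.x₃ * h.x₄ - g.x₄ * h.x₃)⟩ := by
  have h0 := p_mul_p (p := p)
  rw [commutatorElement_def, mul_inv_eq_iff_eq_mul, mul_inv_eq_iff_eq_mul]
  ext <;> simp <;> grind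

theorem pow_eq (g : Model p) (n : ℕ) : g ^ n =
    ⟨n * g.x₁ + p * (n.choose 2 * (g.x₁ * g.x₃ - g.x₁ * g.x₄)),
     n * g.x₂ + p * (n.choose 2 * (g.x₁ * g.x₄)),
     n * g.x₃ + p * (n.choose 2 * (g.x₂ * g.x₃)),
     n * g.x₄ + p * (n.choose 2 * (g.x₂ * g.x₄ - g.x₂ * g.x₃)),
     n * g.s + n.choose 2 * (red p g.x₁ * (red p g.x₂ - red p g.x₄)),
     n * g.t + n.choose 2 * (red p g.x₃ * red p g.x₄)⟩ := by
  have h0 := p_mul_p (p := p)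
  induction n with
  | zero => ext <;> simp
  | succ n ih =>
    have h1 : (n + 1).choose 2 = n.choose 2 + n := by
      rw [Nat.choose_succ_succ' n 1, Nat.choose_one_right, add_comm]
    rw [pow_succ, ih, h1]
    ext <;> simp <;> grind

theorem pow_p_eq (hp : p.Prime) (hodd : p ≠ 2) (g : Model p) : g ^ p =
    ⟨p * g.x₁, p * g.x₂, p * g.x₃, p * g.x₄, 0, 0⟩ := by
  have h0 := p_mul_p (p := p)
  have hdvd : p ∣ p.choose 2 :=
    -- `p` is odd, so the quadratic part of the power formula vanishes.
    hp.dvd_choose_self two_ne_zero (lt_of_le_of_ne hp.two_le hodd.symm)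
  obtain ⟨k, hk⟩ := hdvd
  rw [pow_eq, hk]
  ext <;> simp <;> grind

theorem commutator_commutator (g h k : Model p) : ⁅⁅g, h⁆, k⁆ = 1 := by
  have h0 := p_mul_p (p := p)
  rw [commutator_eq ⁅g, h⁆ k, commutator_eq g h]
  ext <;> simp <;> grind

/-- The generator `a` of the model. -/
def a (p : ℕ) : Model p := ⟨1, 0, 0, 0, 0, 0⟩

/-- The generator `b` of the model. -/
def b (p : ℕ) : Model p := ⟨0, 1, 0, 0, 0, 0⟩

/-- The generator `c` of the model. -/
def c (p : ℕ) : Model p := ⟨0, 0, 1, 0, 0, 0⟩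

/-- The generator `d` of the model. -/
def d (p : ℕ) : Model p := ⟨0, 0, 0, 1, 0, 0⟩

theorem commutator_a_b : ⁅a p, b p⁆ = ⟨0, 0, 0, 0, 1, 0⟩ := by
  rw [commutator_eq]; ext <;> simp [a, b]

theorem commutator_c_d : ⁅c p, d p⁆ = ⟨0, 0, 0, 0, 0, 1⟩ := by
  rw [commutator_eq]; ext <;> simp [c, d]

theorem commutator_a_d : ⁅a p, d p⁆ = ⟨-p, p, 0, 0, -1, 0⟩ := by
  rw [commutator_eq]; ext <;> simp [a, d]

theorem eq_zpow_of_hom {f : ℤ → Model p} (hf : ∀ m n, f (m + n) = f m * f n) (n : ℤ) :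
    f 1 ^ n = f n := by
  let F : Multiplicative ℤ →* Model p := MonoidHom.mk' (fun m => f m.toAdd) fun m n => hf _ _
  have := (map_zpow F (Multiplicative.ofAdd 1) n).symm
  rw [← ofAdd_zsmul, smul_eq_mul, mul_one] at this
  exact this

/-- The coordinates of an element are the exponents of its normal form. -/
theorem word_eq (n₁ n₂ n₃ n₄ s t : ℤ) :
    d p ^ n₄ * c p ^ n₃ * b p ^ n₂ * a p ^ n₁ * ⁅a p, b p⁆ ^ s * ⁅c p, d p⁆ ^ t =
      ⟨n₁, n₂, n₃, n₄, s, t⟩ := by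
  have ha : a p ^ n₁ = ⟨n₁, 0, 0, 0, 0, 0⟩ := by
    rw [← eq_zpow_of_hom (f := fun n : ℤ => (⟨n, 0, 0, 0, 0, 0⟩ : Model p))
      (by intros; ext <;> simp)]
    simp [a]
  have hb : b p ^ n₂ = ⟨0, n₂, 0, 0, 0, 0⟩ := by
    rw [← eq_zpow_of_hom (f := fun n : ℤ => (⟨0, n, 0, 0, 0, 0⟩ : Model p))
      (by intros; ext <;> simp)]
    simp [b]
  have hc : c p ^ n₃ = ⟨0, 0, n₃, 0, 0, 0⟩ := by
    rw [← eq_zpow_of_hom (f := fun n : ℤ => (⟨0, 0, n, 0, 0, 0⟩ : Model p))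
      (by intros; ext <;> simp)]
    simp [c]
  have hd : d p ^ n₄ = ⟨0, 0, 0, n₄, 0, 0⟩ := by
    rw [← eq_zpow_of_hom (f := fun n : ℤ => (⟨0, 0, 0, n, 0, 0⟩ : Model p))
      (by intros; ext <;> simp)]
    simp [d]
  have hab : ⁅a p, b p⁆ ^ s = ⟨0, 0, 0, 0, s, 0⟩ := by
    rw [← eq_zpow_of_hom (f := fun n : ℤ => (⟨0, 0, 0, 0, n, 0⟩ : Model p))
      (by intros; ext <;> simp),
      commutator_a_b]
    simp
  have hcd : ⁅c p, d p⁆ ^ t = ⟨0, 0, 0, 0, 0, t⟩ := by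
    rw [← eq_zpow_of_hom (f := fun n : ℤ => (⟨0, 0, 0, 0, 0, n⟩ : Model p))
      (by intros; ext <;> simp),
      commutator_c_d]
    simp
  rw [ha, hb, hc, hd, hab, hcd]
  ext <;> simp

theorem exists_word (g : Model p) : ∃ n₁ n₂ n₃ n₄ s t : ℤ,
    d p ^ n₄ * c p ^ n₃ * b p ^ n₂ * a p ^ n₁ * ⁅a p, b p⁆ ^ s * ⁅c p, d p⁆ ^ t = g := by
  obtain ⟨n₁, h₁⟩ := ZMod.intCast_surjective g.x₁
  obtain ⟨n₂, h₂⟩ := ZMod.intCast_surjective g.x₂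
  obtain ⟨n₃, h₃⟩ := ZMod.intCast_surjective g.x₃
  obtain ⟨n₄, h₄⟩ := ZMod.intCast_surjective g.x₄
  obtain ⟨s, hs⟩ := ZMod.intCast_surjective g.s
  obtain ⟨t, ht⟩ := ZMod.intCast_surjective g.t
  exact ⟨n₁, n₂, n₃, n₄, s, t, by rw [word_eq, h₁, h₂, h₃, h₄, hs, ht]⟩

theorem a_pow (hp : p.Prime) (hodd : p ≠ 2) : a p ^ p = ⁅a p, c p⁆ := by
  rw [pow_p_eq hp hodd, commutator_eq]; ext <;> simp [a, c]

theorem b_pow (hp : p.Prime) (hodd : p ≠ 2) : b p ^ p = ⁅a p, b p * c p * d p⁆ := by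
  rw [pow_p_eq hp hodd, commutator_eq]; ext <;> simp [a, b, c, d, p_mul_p]

theorem c_pow (hp : p.Prime) (hodd : p ≠ 2) : c p ^ p = ⁅b p, c p * d p⁆ := by
  rw [pow_p_eq hp hodd, commutator_eq]; ext <;> simp [b, c, d]

theorem d_pow (hp : p.Prime) (hodd : p ≠ 2) : d p ^ p = ⁅b p, d p⁆ := by
  rw [pow_p_eq hp hodd, commutator_eq]; ext <;> simp [b, d]

/-- The commutator subgroup of the model contains all elements that vanish modulo `p` in
`(ZMod p) ^ 4`, because the `p`-th powers of the generators are commutators. -/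
theorem mem_commutator (hp : p.Prime) (hodd : p ≠ 2) {g : Model p} (h₁ : red p g.x₁ = 0)
    (h₂ : red p g.x₂ = 0) (h₃ : red p g.x₃ = 0) (h₄ : red p g.x₄ = 0) :
    g ∈ commutator (Model p) := by
  have hc : ∀ x y : Model p, ⁅x, y⁆ ∈ commutator (Model p) := fun x y =>
    Subgroup.commutator_mem_commutator (Subgroup.mem_top x) (Subgroup.mem_top y)
  obtain ⟨n₁, hn₁⟩ := exists_eq_p_mul h₁
  obtain ⟨n₂, hn₂⟩ := exists_eq_p_mul h₂
  obtain ⟨n₃, hn₃⟩ := exists_eq_p_mul h₃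
  obtain ⟨n₄, hn₄⟩ := exists_eq_p_mul h₄
  obtain ⟨s, hs⟩ := ZMod.intCast_surjective g.s
  obtain ⟨t, ht⟩ := ZMod.intCast_surjective g.t
  have hg := word_eq (p := p) (p * n₁) (p * n₂) (p * n₃) (p * n₄) s t
  rw [← hn₁, ← hn₂, ← hn₃, ← hn₄, hs, ht] at hg
  change _ = g at hg
  rw [← hg]
  simp only [zpow_mul, zpow_natCast, a_pow hp hodd, b_pow hp hodd, c_pow hp hodd, d_pow hp hodd]
  exact mul_mem (mul_mem (mul_mem (mul_mem (mul_mem (zpow_mem (hc _ _) _) (zpow_mem (hc _ _) _))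
    (zpow_mem (hc _ _) _)) (zpow_mem (hc _ _) _)) (zpow_mem (hc _ _) _)) (zpow_mem (hc _ _) _)

/-- The model as a product of its six coordinates, used to count its elements. -/
def equivProd (p : ℕ) : Model p ≃
    ZMod (p ^ 2) × ZMod (p ^ 2) × ZMod (p ^ 2) × ZMod (p ^ 2) × ZMod p × ZMod p where
  toFun g := (g.x₁, g.x₂, g.x₃, g.x₄, g.s, g.t)
  invFun v := ⟨v.1, v.2.1, v.2.2.1, v.2.2.2.1, v.2.2.2.2.1, v.2.2.2.2.2⟩
  left_inv _ := rfl
  right_inv _ := rfl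

theorem card_eq (p : ℕ) : Nat.card (Model p) = p ^ 10 := by
  rw [Nat.card_congr (equivProd p)]
  simp only [Nat.card_prod, Nat.card_zmod]
  ring

end Model

/-! ### Groups of class two and the isomorphism with the model -/

section ClassTwo

variable {G : Type*} [Group G]

theorem commutator_mul_comm_of_class_two (h2 : ∀ x y z : G, ⁅⁅x, y⁆, z⁆ = 1) (x y g : G) :
    ⁅x, y⁆ * g = g * ⁅x, y⁆ :=
  commutatorElement_eq_one_iff_mul_comm.1 (h2 x y g)

theorem commutator_mul_left_of_class_two (h2 : ∀ x y z : G, ⁅⁅x, y⁆, z⁆ = 1) (x y g : G) :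
    ⁅x * y, g⁆ = ⁅x, g⁆ * ⁅y, g⁆ := by
  rw [commutatorElement_mul_left_eq_conj_mul, ← commutator_mul_comm_of_class_two h2 y g x,
    mul_inv_cancel_right, commutator_mul_comm_of_class_two h2]

theorem commutator_mul_right_of_class_two (h2 : ∀ x y z : G, ⁅⁅x, y⁆, z⁆ = 1) (x y g : G) :
    ⁅g, x * y⁆ = ⁅g, x⁆ * ⁅g, y⁆ := by
  rw [← commutatorElement_inv, commutator_mul_left_of_class_two h2, mul_inv_rev,
    commutatorElement_inv, commutatorElement_inv, commutator_mul_comm_of_class_two h2]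

theorem commutator_zpow_of_class_two (h2 : ∀ x y z : G, ⁅⁅x, y⁆, z⁆ = 1) (x y : G) (m n : ℤ) :
    ⁅x ^ m, y ^ n⁆ = ⁅x, y⁆ ^ (m * n) := by
  have hl := map_zpow (MonoidHom.mk' (fun g => ⁅g, y ^ n⁆)
    fun g g' => commutator_mul_left_of_class_two h2 g g' (y ^ n)) x m
  have hr := map_zpow (MonoidHom.mk' (fun g => ⁅x, g⁆)
    fun g g' => commutator_mul_right_of_class_two h2 g g' x) y n
  simp only [MonoidHom.mk'_apply] at hl hr
  rw [hl, hr, ← zpow_mul, mul_comm]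

theorem zpow_mul_zpow_of_class_two (h2 : ∀ x y z : G, ⁅⁅x, y⁆, z⁆ = 1) (x y : G) (m n : ℤ) :
    x ^ m * y ^ n = y ^ n * x ^ m * ⁅x, y⁆ ^ (m * n) := by
  rw [← commutator_zpow_of_class_two h2, ← commutator_mul_comm_of_class_two h2,
    commutatorElement_def]
  group

/-- In a group of class 2 generated by elements that satisfy the relations of `H`, every element has
a normal form. This bounds the order of `H` from above. -/
theorem exists_word_of_relations (p : ℕ) (h2 : ∀ x y z : G, ⁅⁅x, y⁆, z⁆ = 1) {a b c d : G}
    (ha : a ^ p = ⁅a, c⁆) (hb : b ^ p = ⁅a, b * c * d⁆) (hc : c ^ p = ⁅b, c * d⁆)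
    (hd : d ^ p = ⁅b, d⁆) (hgen : Subgroup.closure {a, b, c, d} = ⊤) (x : G) :
    ∃ n₁ n₂ n₃ n₄ s t : ℤ,
      d ^ n₄ * c ^ n₃ * b ^ n₂ * a ^ n₁ * ⁅a, b⁆ ^ s * ⁅c, d⁆ ^ t = x := by
  -- The six central elements `a ^ p`, `b ^ p`, `c ^ p`, `d ^ p`, `[a, b]`, `[c, d]` generate a
  -- subgroup `Z` that contains all commutators of generators.
  set Z : Subgroup G := Subgroup.closure {a ^ p, b ^ p, c ^ p, d ^ p, ⁅a, b⁆, ⁅c, d⁆} with hZ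
  have haZ : a ^ p ∈ Z := Subgroup.subset_closure (by simp)
  have hbZ : b ^ p ∈ Z := Subgroup.subset_closure (by simp)
  have hcZ : c ^ p ∈ Z := Subgroup.subset_closure (by simp)
  have hdZ : d ^ p ∈ Z := Subgroup.subset_closure (by simp)
  have hab : ⁅a, b⁆ ∈ Z := Subgroup.subset_closure (by simp)
  have hcd : ⁅c, d⁆ ∈ Z := Subgroup.subset_closure (by simp)
  have hac : ⁅a, c⁆ ∈ Z := ha ▸ haZ
  have hbd : ⁅b, d⁆ ∈ Z := hd ▸ hdZ
  have hbc : ⁅b, c⁆ ∈ Z := by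
    rw [commutator_mul_right_of_class_two h2] at hc
    exact (Z.mul_mem_cancel_right hbd).1 (hc ▸ hcZ)
  have had : ⁅a, d⁆ ∈ Z := by
    rw [commutator_mul_right_of_class_two h2, commutator_mul_right_of_class_two h2] at hb
    exact (Z.mul_mem_cancel_left (Z.mul_mem hab hac)).1 (hb ▸ hbZ)
  have comm := commutator_mul_comm_of_class_two h2
  -- `S` is the set of normal forms; it absorbs `Z` and is stable under the generators.
  let S : Set G := {x | ∃ n₁ n₂ n₃ n₄ s t : ℤ,
    d ^ n₄ * c ^ n₃ * b ^ n₂ * a ^ n₁ * ⁅a, b⁆ ^ s * ⁅c, d⁆ ^ t = x}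
  have absorb_zpow : ∀ z ∈ ({a ^ p, b ^ p, c ^ p, d ^ p, ⁅a, b⁆, ⁅c, d⁆} : Set G),
      ∀ k : ℤ, ∀ w ∈ S, w * z ^ k ∈ S := by
    rintro z hz k _ ⟨n₁, n₂, n₃, n₄, s, t, rfl⟩
    have hzc : ∀ g, z ^ k * g = g * z ^ k := by
      have : ∀ g, Commute z g := by
        rcases hz with rfl | rfl | rfl | rfl | rfl | rfl
        · rw [ha]; exact comm _ _
        · rw [hb]; exact comm _ _
        · rw [hc]; exact comm _ _
        · rw [hd]; exact comm _ _
        · exact comm _ _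
        · exact comm _ _
      exact fun g => ((this g).zpow_left k)
    rcases hz with rfl | rfl | rfl | rfl | rfl | rfl
    · refine ⟨n₁ + p * k, n₂, n₃, n₄, s, t, ?_⟩
      rw [zpow_add, zpow_mul, zpow_natCast]
      simp only [mul_assoc, hzc]
    · refine ⟨n₁, n₂ + p * k, n₃, n₄, s, t, ?_⟩
      rw [zpow_add, zpow_mul, zpow_natCast]
      simp only [mul_assoc, hzc]
    · refine ⟨n₁, n₂, n₃ + p * k, n₄, s, t, ?_⟩
      rw [zpow_add, zpow_mul, zpow_natCast]
      simp only [mul_assoc, hzc]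
    · refine ⟨n₁, n₂, n₃, n₄ + p * k, s, t, ?_⟩
      rw [zpow_add, zpow_mul, zpow_natCast]
      simp only [mul_assoc, hzc]
    · refine ⟨n₁, n₂, n₃, n₄, s + k, t, ?_⟩
      rw [zpow_add]
      simp only [mul_assoc, hzc]
    · refine ⟨n₁, n₂, n₃, n₄, s, t + k, ?_⟩
      rw [zpow_add]
      simp only [mul_assoc]
  have absorb : ∀ z ∈ Z, ∀ w ∈ S, w * z ∈ S ∧ w * z⁻¹ ∈ S := by
    intro z hz
    induction hz using Subgroup.closure_induction with
    | mem z hz =>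
      exact fun w hw => ⟨by simpa using absorb_zpow z hz 1 w hw,
        by simpa using absorb_zpow z hz (-1) w hw⟩
    | one => simp
    | mul y z _ _ hy hz =>
      intro w hw
      rw [mul_inv_rev, ← mul_assoc, ← mul_assoc]
      exact ⟨(hz _ (hy w hw).1).1, (hy _ (hz w hw).2).2⟩
    | inv z _ hz =>
      intro w hw
      rw [inv_inv]
      exact (hz w hw).symm
  have key := zpow_mul_zpow_of_class_two h2
  have czpow : ∀ (x y : G) (k : ℤ) (g : G), ⁅x, y⁆ ^ k * g = g * ⁅x, y⁆ ^ k := fun x y k g =>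
    (show Commute ⁅x, y⁆ g from comm x y g).zpow_left k
  have push : ∀ (x y : G) (m n : ℤ) (g : G),
      x ^ m * (y ^ n * g) = y ^ n * (x ^ m * g) * ⁅x, y⁆ ^ (m * n) := fun x y m n g => by
    rw [← mul_assoc, key, mul_assoc, czpow]
    simp only [mul_assoc]
  have left : ∀ g ∈ ({a, b, c, d} : Set G), ∀ m : ℤ, ∀ w ∈ S, g ^ m * w ∈ S := by
    rintro g hg m _ ⟨n₁, n₂, n₃, n₄, s, t, rfl⟩
    rcases hg with rfl | rfl | rfl | rfl
    · have := (absorb _ (Z.mul_mem (Z.zpow_mem hab (m * n₂)) (Z.mul_mem (Z.zpow_mem hac (m * n₃))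
        (Z.zpow_mem had (m * n₄)))) _ ⟨n₁ + m, n₂, n₃, n₄, s, t, rfl⟩).1
      rw [add_comm n₁, zpow_add] at this
      convert this using 1
      simp only [mul_assoc, push g d, push g c, push g b]
    · have := (absorb _ (Z.mul_mem (Z.zpow_mem hbc (m * n₃))
        (Z.zpow_mem hbd (m * n₄))) _ ⟨n₁, n₂ + m, n₃, n₄, s, t, rfl⟩).1
      rw [add_comm n₂, zpow_add] at this
      convert this using 1
      simp only [mul_assoc, push g d, push g c]
    · have := (absorb _ (Z.zpow_mem hcd (m * n₄)) _ ⟨n₁, n₂, n₃ + m, n₄, s, t, rfl⟩).1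
      rw [add_comm n₃, zpow_add] at this
      convert this using 1
      simp only [mul_assoc, push g d]
    · refine ⟨n₁, n₂, n₃, m + n₄, s, t, ?_⟩
      rw [zpow_add]
      simp only [mul_assoc]
  have hx : x ∈ Subgroup.closure {a, b, c, d} := hgen ▸ Subgroup.mem_top x
  change x ∈ S
  induction hx using Subgroup.closure_induction_left with
  | one => exact ⟨0, 0, 0, 0, 0, 0, by simp⟩
  | mul_left g hg y _ hy => simpa using left g hg 1 y hy
  | inv_mul_cancel g hg y _ hy => simpa using left g hg (-1) y hy

end ClassTwo

namespace GroupH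

variable {p : ℕ}

theorem commutator_commutator (x y z : GroupH p) : ⁅⁅x, y⁆, z⁆ = 1 := by
  obtain ⟨x, rfl⟩ := PresentedGroup.mk_surjective _ x
  obtain ⟨y, rfl⟩ := PresentedGroup.mk_surjective _ y
  obtain ⟨z, rfl⟩ := PresentedGroup.mk_surjective _ z
  rw [← map_commutatorElement, ← map_commutatorElement]
  exact PresentedGroup.one_of_mem (GroupHRel.class_two x y z)

theorem a_pow (p : ℕ) : a p ^ p = ⁅a p, c p⁆ :=
  PresentedGroup.mk_eq_mk_of_mul_inv_mem (GroupHRel.a_pow (p := p))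

theorem b_pow (p : ℕ) : b p ^ p = ⁅a p, b p * c p * d p⁆ :=
  PresentedGroup.mk_eq_mk_of_mul_inv_mem (GroupHRel.b_pow (p := p))

theorem c_pow (p : ℕ) : c p ^ p = ⁅b p, c p * d p⁆ :=
  PresentedGroup.mk_eq_mk_of_mul_inv_mem (GroupHRel.c_pow (p := p))

theorem d_pow (p : ℕ) : d p ^ p = ⁅b p, d p⁆ :=
  PresentedGroup.mk_eq_mk_of_mul_inv_mem (GroupHRel.d_pow (p := p))

theorem closure_generators (p : ℕ) :
    Subgroup.closure {a p, b p, c p, d p} = (⊤ : Subgroup (GroupH p)) := by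
  rw [← PresentedGroup.closure_range_of]
  congr 1
  ext x
  simp only [Set.mem_insert_iff, Set.mem_singleton_iff, Set.mem_range, Fin.exists_fin_succ,
    Fin.exists_fin_zero]
  simp [a, b, c, d, eq_comm]

theorem exists_hom {L : Type*} [Group L] (h2 : ∀ x y z : L, ⁅⁅x, y⁆, z⁆ = 1) {a' b' c' d' : L}
    (ha : a' ^ p = ⁅a', c'⁆) (hb : b' ^ p = ⁅a', b' * c' * d'⁆) (hc : c' ^ p = ⁅b', c' * d'⁆)
    (hd : d' ^ p = ⁅b', d'⁆) :
    ∃ f : GroupH p →* L, f (a p) = a' ∧ f (b p) = b' ∧ f (c p) = c' ∧ f (d p) = d' := by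
  have h : ∀ r ∈ {r | GroupHRel p r}, FreeGroup.lift ![a', b', c', d'] r = 1 := by
    rintro _ (⟨x, y, z⟩ | _ | _ | _ | _)
    · simp only [map_commutatorElement, h2]
    all_goals
      simp only [map_mul, map_inv, map_pow, map_commutatorElement, FreeGroup.lift_apply_of]
      rw [mul_inv_eq_one]
      simpa
  exact ⟨PresentedGroup.toGroup h, PresentedGroup.toGroup.of h, PresentedGroup.toGroup.of h,
    PresentedGroup.toGroup.of h, PresentedGroup.toGroup.of h⟩

/-- `H` is isomorphic to the model, by an isomorphism that matches the generators: the homomorphism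
given by the presentation sends a normal form to the tuple of its exponents. -/
theorem exists_equiv_model (hp : p.Prime) (hodd : p ≠ 2) :
    ∃ θ : GroupH p ≃* Model p, θ (a p) = Model.a p ∧ θ (b p) = Model.b p ∧
      θ (c p) = Model.c p ∧ θ (d p) = Model.d p := by
  obtain ⟨θ, ha, hb, hc, hd⟩ := exists_hom (p := p) (a' := Model.a p) (b' := Model.b p)
    (c' := Model.c p) (d' := Model.d p) Model.commutator_commutator
    (Model.a_pow hp hodd) (Model.b_pow hp hodd) (Model.c_pow hp hodd) (Model.d_pow hp hodd)
  have hword : ∀ n₁ n₂ n₃ n₄ s t : ℤ, θ (d p ^ n₄ * c p ^ n₃ * b p ^ n₂ * a p ^ n₁ *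
      ⁅a p, b p⁆ ^ s * ⁅c p, d p⁆ ^ t) = ⟨n₁, n₂, n₃, n₄, s, t⟩ := fun n₁ n₂ n₃ n₄ s t => by
    simp only [map_mul, map_zpow, map_commutatorElement, ha, hb, hc, hd, Model.word_eq]
  have hcomm : ∀ x u v w : GroupH p, x ^ p = ⁅u, v⁆ → ∀ n : ℤ, (n : ZMod p) = 0 →
      ⁅x, w⁆ ^ n = 1 := by
    intro x u v w hx n hn
    obtain ⟨k, rfl⟩ := (ZMod.intCast_zmod_eq_zero_iff_dvd _ _).1 hn
    have h := commutator_zpow_of_class_two commutator_commutator x w p 1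
    rw [zpow_natCast, hx, commutator_commutator, mul_one] at h
    rw [zpow_mul, ← h, one_zpow]
  have hpow : ∀ g x w u v : GroupH p, g ^ p = ⁅x, w⁆ → x ^ p = ⁅u, v⁆ →
      ∀ n : ℤ, (n : ZMod (p ^ 2)) = 0 → g ^ n = 1 := by
    intro g x w u v hg hx n hn
    obtain ⟨k, rfl⟩ := (ZMod.intCast_zmod_eq_zero_iff_dvd _ _).1 hn
    rw [zpow_mul, zpow_natCast, pow_two, pow_mul, hg, ← zpow_natCast,
      hcomm x u v w hx p (by simp), one_zpow]
  refine ⟨MulEquiv.ofBijective θ ⟨?_, ?_⟩, ha, hb, hc, hd⟩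
  · rw [injective_iff_map_eq_one]
    intro x hx
    obtain ⟨n₁, n₂, n₃, n₄, s, t, rfl⟩ := exists_word_of_relations p commutator_commutator
      (a_pow p) (b_pow p) (c_pow p) (d_pow p) (closure_generators p) x
    rw [hword] at hx
    rw [hpow _ _ _ _ _ (a_pow p) (a_pow p) _ (congrArg Model.x₁ hx),
      hpow _ _ _ _ _ (b_pow p) (a_pow p) _ (congrArg Model.x₂ hx),
      hpow _ _ _ _ _ (c_pow p) (b_pow p) _ (congrArg Model.x₃ hx),
      hpow _ _ _ _ _ (d_pow p) (b_pow p) _ (congrArg Model.x₄ hx),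
      hcomm _ _ _ _ (a_pow p) _ (congrArg Model.s hx),
      hcomm _ _ _ _ (c_pow p) _ (congrArg Model.t hx)]
    simp
  · intro g
    obtain ⟨n₁, n₂, n₃, n₄, s, t, rfl⟩ := Model.exists_word g
    exact ⟨_, (hword n₁ n₂ n₃ n₄ s t).trans (Model.word_eq n₁ n₂ n₃ n₄ s t).symm⟩

end GroupH

/-! ### Central products with a cyclic group of order `p ^ 2` -/

/-- `G` is the central product of `H`, embedded by `ι`, with `⟨z⟩`, where `z ^ p = ι m` and `p` is the
order of `z` modulo `ι H`. Compared with `IsGroupG₁`, the generator `z` is normalized so that its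
`p`-th power is a prescribed element `m` of the amalgamated subgroup, and `H` is arbitrary. -/
structure IsCentralProductWith (p : ℕ) {H G : Type*} [Group H] [Group G] (m : H) (ι : H →* G)
    (z : G) : Prop where
  injective : Function.Injective ι
  commute : ∀ h, Commute (ι h) z
  exists_eq : ∀ g, ∃ (h : H) (n : ℤ), ι h * z ^ n = g
  pow_eq : z ^ p = ι m
  dvd_of_mem : ∀ n : ℤ, z ^ n ∈ ι.range → (p : ℤ) ∣ n

namespace IsCentralProductWith

variable {p : ℕ} {H G : Type*} [Group H] [Group G] {m : H} {ι : H →* G} {z : G}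

theorem comp_symm (hz : IsCentralProductWith p m ι z) {K : Type*} [Group K] (θ : H ≃* K) :
    IsCentralProductWith p (θ m) (ι.comp θ.symm.toMonoidHom) z where
  injective := hz.injective.comp θ.symm.injective
  commute k := hz.commute (θ.symm k)
  exists_eq g := by
    obtain ⟨h, n, rfl⟩ := hz.exists_eq g
    exact ⟨θ h, n, by simp⟩
  pow_eq := by simpa using hz.pow_eq
  dvd_of_mem n := by
    rintro ⟨k, hk⟩
    exact hz.dvd_of_mem n ⟨θ.symm k, hk⟩

theorem zpow_mul_eq (hz : IsCentralProductWith p m ι z) (n : ℤ) : z ^ (p * n) = ι (m ^ n) := by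
  rw [zpow_mul, zpow_natCast, hz.pow_eq, map_zpow]

theorem mul_zpow_mul (hz : IsCentralProductWith p m ι z) (h k : H) (i j : ℤ) :
    ι h * z ^ i * (ι k * z ^ j) = ι (h * k) * z ^ (i + j) := by
  rw [map_mul, zpow_add, mul_assoc, mul_assoc, ← mul_assoc (z ^ i),
    (((hz.commute k).zpow_right i).eq).symm, mul_assoc]

theorem commutator_eq (hz : IsCentralProductWith p m ι z) (h k : H) (i j : ℤ) :
    ⁅ι h * z ^ i, ι k * z ^ j⁆ = ι ⁅h, k⁆ := by
  rw [commutatorElement_def, mul_inv_eq_iff_eq_mul, mul_inv_eq_iff_eq_mul,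
    hz.mul_zpow_mul, mul_assoc, hz.mul_zpow_mul, ← mul_assoc, ← map_mul, add_comm]
  congr 2
  rw [commutatorElement_def]
  group

theorem mul_zpow_pow (hz : IsCentralProductWith p m ι z) (h : H) (i : ℤ) :
    (ι h * z ^ i) ^ p = ι (h ^ p * m ^ i) := by
  rw [((hz.commute h).zpow_right i).mul_pow, map_mul, ← hz.zpow_mul_eq, map_pow, ← zpow_natCast,
    ← zpow_natCast, ← zpow_mul, mul_comm (p : ℤ)]

theorem commute_of_forall (hz : IsCentralProductWith p m ι z) (g : G) : Commute g z := by
  obtain ⟨h, n, rfl⟩ := hz.exists_eq g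
  exact (hz.commute h).mul_left ((Commute.refl z).zpow_left n)

theorem finite (hz : IsCentralProductWith p m ι z) (hp : p.Prime) [Finite H] : Finite G := by
  have hfin : IsOfFinOrder z := by
    refine IsOfFinOrder.of_pow ?_ hp.ne_zero
    rw [hz.pow_eq]
    exact ι.isOfFinOrder (isOfFinOrder_of_finite m)
  have : Finite (Subgroup.zpowers z) := hfin.finite_zpowers
  refine Finite.of_surjective (fun x : H × Subgroup.zpowers z => ι x.1 * x.2) fun g => ?_
  obtain ⟨h, n, rfl⟩ := hz.exists_eq g
  exact ⟨(h, ⟨z ^ n, n, rfl⟩), rfl⟩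

theorem isPGroup (hz : IsCentralProductWith p m ι z) (hH : IsPGroup p H) : IsPGroup p G := by
  intro g
  obtain ⟨h, n, rfl⟩ := hz.exists_eq g
  obtain ⟨k, hk⟩ := hH (h ^ p * m ^ n)
  refine ⟨k + 1, ?_⟩
  rw [pow_succ', pow_mul, hz.mul_zpow_pow, ← map_pow, hk, map_one]

theorem commutator_le_range (hz : IsCentralProductWith p m ι z) : commutator G ≤ ι.range := by
  rw [commutator_def, Subgroup.commutator_le]
  intro g _ g' _
  obtain ⟨h, i, rfl⟩ := hz.exists_eq g
  obtain ⟨k, j, rfl⟩ := hz.exists_eq g'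
  exact ⟨_, (hz.commutator_eq h k i j).symm⟩

/-- The element `z` is central but lies outside `ι H`, which contains `G'`. -/
theorem not_isSpecial (hz : IsCentralProductWith p m ι z) (hp : p.Prime) : ¬ IsSpecial p G := by
  rintro ⟨-, hcenter, -⟩
  have hmem : z ∈ Subgroup.center G :=
    Subgroup.mem_center_iff.2 fun g => hz.commute_of_forall g
  rw [hcenter] at hmem
  have h := hz.dvd_of_mem 1 (by simpa using hz.commutator_le_range hmem)
  exact hp.one_lt.ne' (by exact_mod_cast Int.eq_one_of_dvd_one (by positivity) h)

/-- The universal property of the central product: a homomorphism on `H` and an image `y` of `z` that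
satisfies the same relations extend to `G`. -/
theorem exists_hom (hz : IsCentralProductWith p m ι z) {L : Type*} [Group L] (f : H →* L) {y : L}
    (hy : ∀ h, Commute (f h) y) (hm : y ^ p = f m) :
    ∃ F : G →* L, (∀ h, F (ι h) = f h) ∧ F z = y := by
  let π : H × Multiplicative ℤ →* G := ι.noncommCoprod (zpowersHom G z)
    fun h n => (hz.commute h).zpow_right _
  let ρ : H × Multiplicative ℤ →* L := f.noncommCoprod (zpowersHom L y)
    fun h n => (hy h).zpow_right _
  have hπ : Function.Surjective π := fun g => by
    obtain ⟨h, n, rfl⟩ := hz.exists_eq g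
    exact ⟨(h, Multiplicative.ofAdd n), rfl⟩
  have hker : π.ker ≤ ρ.ker := by
    rintro ⟨h, n⟩ hx
    have hx' : ι h * z ^ n.toAdd = 1 := hx
    change f h * y ^ n.toAdd = 1
    obtain ⟨k, hk⟩ := hz.dvd_of_mem n.toAdd ⟨h⁻¹, by rw [map_inv, inv_eq_of_mul_eq_one_right hx']⟩
    rw [hk, hz.zpow_mul_eq, ← map_mul, map_eq_one_iff ι hz.injective] at hx'
    rw [hk, zpow_mul, zpow_natCast, hm, ← map_zpow, ← map_mul, hx', map_one]
  have hF := MonoidHom.liftOfRightInverse_comp_apply π _ (Function.rightInverse_surjInv hπ)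
    ⟨ρ, hker⟩
  have hπ₁ : ∀ h, π (h, 1) = ι h := fun h =>
    (congrArg (ι h * ·) (zpow_zero z)).trans (mul_one _)
  have hπ₂ : π (1, Multiplicative.ofAdd 1) = z :=
    (congrArg₂ (· * ·) (map_one ι) (zpow_one z)).trans (one_mul z)
  refine ⟨π.liftOfSurjective hπ ⟨ρ, hker⟩, fun h => ?_, ?_⟩
  · rw [← hπ₁]
    exact (hF _).trans ((congrArg (f h * ·) (zpow_zero y)).trans (mul_one _))
  · rw [← hπ₂]
    exact (hF _).trans ((congrArg₂ (· * ·) (map_one f) (zpow_one y)).trans (one_mul y))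

end IsCentralProductWith

namespace IsGroupG₁

variable {p : ℕ} {M : Subgroup (GroupH p)} {G : Type*} [Group G] {ι : GroupH p →* G} {z : G}

/-- If `m` generates `M`, then some power of `z` with exponent prime to `p` has `m` as its `p`-th
power. -/
theorem exists_isCentralProductWith (hp : p.Prime) (hG : IsGroupG₁ p M ι z) {m : GroupH p}
    (hm : orderOf m = p) (hM : M = Subgroup.zpowers m) :
    ∃ z' : G, IsCentralProductWith p m ι z' := by
  have hp0 : (p : ℤ) ≠ 0 := by exact_mod_cast hp.ne_zero
  have hpZ : Prime (p : ℤ) := Nat.prime_iff_prime_int.1 hp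
  have hmp : m ^ p = 1 := orderOf_dvd_iff_pow_eq_one.1 hm.dvd
  have hz1 : ∀ n : ℤ, z ^ n = 1 ↔ (p * p : ℤ) ∣ n := fun n => by
    rw [← orderOf_dvd_iff_zpow_eq_one, hG.orderOf_eq, pow_two, Nat.cast_mul]
  have hinf := hG.product.inf_eq
  have hdvd : ∀ n : ℤ, z ^ n ∈ ι.range → (p : ℤ) ∣ n := by
    intro n hn
    have hmem : z ^ n ∈ M.map ι := hinf ▸ ⟨hn, n, rfl⟩
    rw [hM] at hmem
    obtain ⟨_, ⟨k, rfl⟩, hk⟩ := hmem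
    rw [← mul_dvd_mul_iff_right hp0, ← hz1, zpow_mul, zpow_natCast, ← hk, ← map_pow]
    change ι ((m ^ k) ^ p) = 1
    rw [← zpow_natCast, zpow_comm, zpow_natCast, hmp, one_zpow, map_one]
  have hmem : ι m ∈ M.map ι := ⟨m, hM ▸ Subgroup.mem_zpowers m, rfl⟩
  rw [← hinf] at hmem
  obtain ⟨k, hk : z ^ k = ι m⟩ := hmem.2
  obtain ⟨j, rfl⟩ := hdvd k (hk ▸ hmem.1)
  have hj : ¬ (p : ℤ) ∣ j := fun h => by
    rw [(hz1 _).2 (mul_dvd_mul_left _ h)] at hk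
    rw [eq_comm, map_eq_one_iff ι hG.injective, ← orderOf_eq_one_iff, hm] at hk
    exact hp.one_lt.ne' hk
  obtain ⟨u, v, huv⟩ : IsCoprime j (p * p : ℤ) :=
    ((hpZ.coprime_iff_not_dvd.2 hj).mul_left (hpZ.coprime_iff_not_dvd.2 hj)).symm
  have hzu : (z ^ j) ^ u = z := by
    have : z ^ (v * (p * p : ℤ)) = 1 := (hz1 _).2 (dvd_mul_left _ _)
    rw [← zpow_mul, mul_comm, ← mul_one (z ^ (u * j)), ← this, ← zpow_add, huv, zpow_one]
  have hcomm : ∀ h, Commute (ι h) z := fun h =>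
    (mul_inv_eq_iff_eq_mul.1 (hG.product.comm _ ⟨h, rfl⟩ z (Subgroup.mem_zpowers z))).symm
  refine ⟨z ^ j, hG.injective, fun h => (hcomm h).zpow_right j, fun g => ?_, ?_, fun n hn => ?_⟩
  · obtain ⟨_, ⟨h, rfl⟩, _, ⟨n, rfl⟩, rfl⟩ := hG.product.mul_eq g
    exact ⟨h, u * n, by rw [zpow_mul, hzu]⟩
  · rw [← hk, mul_comm, zpow_mul, zpow_natCast]
  · rw [← zpow_mul] at hn
    exact (hpZ.dvd_or_dvd (hdvd _ hn)).resolve_left hj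

end IsGroupG₁

/-- The central product exists: divide `H × ZMod (p ^ 2)` by the subgroup generated by `(m, -p)`. -/
theorem exists_isGroupG₁ {p : ℕ} (hp : p.Prime) {m : GroupH p} (hm : orderOf m = p)
    (hcentral : ∀ h, Commute m h) :
    ∃ (G : Type) (_ : Group G) (ι : GroupH p →* G) (z : G),
      IsGroupG₁ p (Subgroup.zpowers m) ι z := by
  have hp0 : (p : ℤ) ≠ 0 := by exact_mod_cast hp.ne_zero
  let C := Multiplicative (ZMod (p ^ 2))
  let t : C := Multiplicative.ofAdd 1
  have ht : ∀ n : ℤ, t ^ n = 1 ↔ (p * p : ℤ) ∣ n := fun n => by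
    rw [← ofAdd_zsmul, ofAdd_eq_one, zsmul_one, ZMod.intCast_zmod_eq_zero_iff_dvd, Nat.cast_pow,
      pow_two]
  -- `(m, -p)` in multiplicative notation
  let x : GroupH p × C := (m, t ^ (-p : ℤ))
  have hxc : ∀ y, Commute x y := fun y => Prod.ext (hcentral y.1) (mul_comm _ _)
  let N : Subgroup (GroupH p × C) := Subgroup.zpowers x
  have : N.Normal := ⟨by
    rintro _ ⟨n, rfl⟩ y
    rw [← ((hxc y).zpow_left n).eq, mul_inv_cancel_right]
    exact ⟨n, rfl⟩⟩
  have hmz : ∀ n : ℤ, m ^ n = 1 ↔ (p : ℤ) ∣ n := fun n => by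
    rw [← orderOf_dvd_iff_zpow_eq_one, hm]
  have hN : ∀ (h : GroupH p) (n : ℤ), (h, t ^ n) ∈ N ↔
      ∃ k : ℤ, m ^ k = h ∧ (p * p : ℤ) ∣ n + p * k := fun h n => by
    refine exists_congr fun k => ?_
    have h1 : t ^ (n + p * k : ℤ) = t ^ n * ((t ^ (-p : ℤ)) ^ k)⁻¹ := by
      rw [zpow_add, ← zpow_mul, ← zpow_neg, neg_mul, neg_neg]
    rw [← ht, h1, mul_inv_eq_one, eq_comm (a := t ^ n)]
    exact Prod.ext_iff
  let π := QuotientGroup.mk' N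
  let ι : GroupH p →* (GroupH p × C) ⧸ N := π.comp (MonoidHom.inl _ _)
  have hπ : ∀ y, π y = 1 ↔ y ∈ N := QuotientGroup.eq_one_iff
  have hιz : ∀ (h : GroupH p) (n : ℤ), ι h * π (1, t) ^ n = π (h, t ^ n) := fun h n => by
    rw [← map_zpow]
    change π _ * π _ = _
    rw [← map_mul]
    simp
  refine ⟨(GroupH p × C) ⧸ N, inferInstance, ι, π (1, t), ?_, ?_, ⟨⟨?_, ?_, ?_⟩, ?_⟩⟩
  · rw [injective_iff_map_eq_one]
    intro h hh
    have h1 := hιz h 0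
    rw [hh, zpow_zero, one_mul, eq_comm, hπ, hN] at h1
    obtain ⟨k, rfl, hk⟩ := h1
    rw [zero_add, mul_dvd_mul_iff_left hp0] at hk
    exact (hmz k).2 hk
  · have hz : ∀ n : ℤ, π (1, t) ^ n = 1 ↔ (p * p : ℤ) ∣ n := fun n => by
      rw [← one_mul (π (1, t) ^ n), ← map_one ι, hιz, map_one, hπ, hN]
      constructor
      · rintro ⟨k, hk, hd⟩
        exact (dvd_add_left (mul_dvd_mul_left _ ((hmz k).1 hk))).1 hd
      · exact fun h => ⟨0, zpow_zero m, by simpa using h⟩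
    refine Nat.dvd_antisymm ?_ ?_
    · rw [orderOf_dvd_iff_pow_eq_one, ← zpow_natCast, hz, Nat.cast_pow, pow_two]
    · have := (hz (orderOf (π (1, t)))).1 (by rw [zpow_natCast, pow_orderOf_eq_one])
      exact (pow_two p).dvd.trans (by exact_mod_cast this)
  · refine ⟨?_⟩
    rintro _ ⟨h, rfl⟩ g
    obtain ⟨⟨k, c⟩, rfl⟩ := QuotientGroup.mk'_surjective N g
    refine ⟨k * h * k⁻¹, ?_⟩
    change π _ = π _ * π _ * (π _)⁻¹
    rw [← map_mul, ← map_inv, ← map_mul]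
    congr 1
    ext <;> simp
  · intro g
    obtain ⟨⟨k, c⟩, rfl⟩ := QuotientGroup.mk'_surjective N g
    obtain ⟨n, hn⟩ := ZMod.intCast_surjective c.toAdd
    refine ⟨ι k, ⟨k, rfl⟩, π (1, t) ^ n, ⟨n, rfl⟩, ?_⟩
    rw [hιz]
    congr 2
    rw [← ofAdd_zsmul, zsmul_one, hn, ofAdd_toAdd]
  · apply le_antisymm
    · rintro _ ⟨⟨h, rfl⟩, n, hn : _ ^ n = _⟩
      have h1 := hιz h (-n)
      rw [zpow_neg, hn, mul_inv_cancel, eq_comm, hπ, hN] at h1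
      obtain ⟨k, rfl, -⟩ := h1
      exact ⟨m ^ k, ⟨k, rfl⟩, rfl⟩
    · rintro _ ⟨_, ⟨k, rfl⟩, rfl⟩
      refine ⟨⟨_, rfl⟩, p * k, ?_⟩
      change π (1, t) ^ (p * k : ℤ) = _
      rw [← mul_right_inj (ι (m ^ k))⁻¹, inv_mul_cancel, ← map_inv, hιz, hπ, hN]
      exact ⟨-k, zpow_neg m k, by simp⟩
  · rintro _ ⟨h, rfl⟩ _ ⟨n, rfl⟩
    change π (1, t) ^ n * π (h, 1) * (π (1, t) ^ n)⁻¹ = π (h, 1)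
    rw [← map_zpow, ← map_inv, ← map_mul, ← map_mul]
    congr 1
    ext <;> simp

/-! ### Automorphisms acting trivially modulo the commutator subgroup -/

/-- If `G` has class at most 2 and every automorphism acts trivially on `G ⧸ G'`, then every
automorphism fixes `G'` pointwise, and hence any two automorphisms commute. -/
theorem mulAut_mul_comm {G : Type*} [Group G] (hG : commutator G ≤ Subgroup.center G)
    (h : ∀ (φ : MulAut G) (g : G), g⁻¹ * φ g ∈ commutator G) (φ ψ : MulAut G) :
    φ * ψ = ψ * φ := by
  have h2 : ∀ x y z : G, ⁅⁅x, y⁆, z⁆ = 1 := fun x y z =>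
    commutatorElement_eq_one_iff_mul_comm.2 (Subgroup.mem_center_iff.1 (hG
      (Subgroup.commutator_mem_commutator (Subgroup.mem_top x) (Subgroup.mem_top y))) z).symm
  have fix : ∀ (φ : MulAut G), ∀ u ∈ commutator G, φ u = u := by
    intro φ u hu
    rw [commutator_def, Subgroup.commutator_def] at hu
    induction hu using Subgroup.closure_induction with
    | mem u hu =>
      obtain ⟨x, -, y, -, rfl⟩ := hu
      obtain ⟨v, hv, hx⟩ : ∃ v ∈ Subgroup.center G, φ x = x * v :=
        ⟨x⁻¹ * φ x, hG (h φ x), by rw [mul_inv_cancel_left]⟩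
      obtain ⟨w, hw, hy⟩ : ∃ w ∈ Subgroup.center G, φ y = y * w :=
        ⟨y⁻¹ * φ y, hG (h φ y), by rw [mul_inv_cancel_left]⟩
      rw [map_commutatorElement, hx, hy, commutator_mul_left_of_class_two h2,
        commutator_mul_right_of_class_two h2,
        commutatorElement_eq_one_iff_mul_comm.2 (Subgroup.mem_center_iff.1 hw x),
        commutatorElement_eq_one_iff_mul_comm.2 (Subgroup.mem_center_iff.1 hv _).symm,
        mul_one, mul_one]
    | one => exact map_one φ
    | mul x y _ _ hx hy => rw [map_mul, hx, hy]
    | inv x _ hx => rw [map_inv, hx]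
  ext g
  have key : ∀ φ ψ : MulAut G, (φ * ψ) g = φ g * (g⁻¹ * ψ g) := fun φ ψ => by
    rw [MulAut.mul_apply, ← fix φ _ (h ψ g), ← map_mul, mul_inv_cancel_left]
  have hc := Subgroup.mem_center_iff.1 (hG (h φ g)) (g⁻¹ * ψ g)
  rw [key, key, ← mul_right_inj g⁻¹, ← mul_assoc, ← mul_assoc _ (ψ g), hc]

/-! ### Linear algebra of the relations -/

/-- Let `P` be the linear map from `F ^ 4` to its exterior square with `P e₁ = e₁ ∧ e₃`,
`P e₂ = e₁ ∧ (e₂ + e₃ + e₄)`, `P e₃ = e₂ ∧ (e₃ + e₄)`, `P e₄ = e₂ ∧ e₄`. A matrix with columns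
`a, b, c, d` that preserves the line of `e₁ ∧ e₂` and is compatible with `P` modulo `e₁ ∧ e₂` and
`e₃ ∧ e₄` is the identity, provided that `2 ≠ 0`.

The hypotheses are the coordinates of the equations that say this, the last four groups of them in
the basis `P e₁, …, P e₄` of the quotient modulo `e₁ ∧ e₂` and `e₃ ∧ e₄`. -/
theorem eq_standard_basis_of_wedge_relations {F : Type*} [Field F] (h2 : (2 : F) ≠ 0)
    {a₁ a₂ a₃ a₄ b₁ b₂ b₃ b₄ c₁ c₂ c₃ c₄ d₁ d₂ d₃ d₄ : F}
    (ab₁₂ : a₁ * b₂ - a₂ * b₁ ≠ 0)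
    (ab₁₃ : a₁ * b₃ - a₃ * b₁ = 0) (ab₁₄ : a₁ * b₄ - a₄ * b₁ = 0) (ab₂₃ : a₂ * b₃ - a₃ * b₂ = 0)
    (ab₂₄ : a₂ * b₄ - a₄ * b₂ = 0)
    (ha₁ : a₁ = (a₁ * c₃ - a₃ * c₁) - (a₁ * c₄ - a₄ * c₁))
    (ha₂ : a₂ = a₁ * c₄ - a₄ * c₁)
    (ha₃ : a₃ = a₂ * c₃ - a₃ * c₂)
    (ha₄ : a₄ = (a₂ * c₄ - a₄ * c₂) - (a₂ * c₃ - a₃ * c₂))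
    (hb₁ : b₁ = (a₁ * (b₃ + c₃ + d₃) - a₃ * (b₁ + c₁ + d₁)) -
      (a₁ * (b₄ + c₄ + d₄) - a₄ * (b₁ + c₁ + d₁)))
    (hb₂ : b₂ = a₁ * (b₄ + c₄ + d₄) - a₄ * (b₁ + c₁ + d₁))
    (hc₁ : c₁ = (b₁ * (c₃ + d₃) - b₃ * (c₁ + d₁)) - (b₁ * (c₄ + d₄) - b₄ * (c₁ + d₁)))
    (hc₂ : c₂ = b₁ * (c₄ + d₄) - b₄ * (c₁ + d₁))
    (hc₃ : c₃ = b₂ * (c₃ + d₃) - b₃ * (c₂ + d₂))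
    (hc₄ : c₄ = (b₂ * (c₄ + d₄) - b₄ * (c₂ + d₂)) - (b₂ * (c₃ + d₃) - b₃ * (c₂ + d₂)))
    (hd₁ : d₁ = (b₁ * d₃ - b₃ * d₁) - (b₁ * d₄ - b₄ * d₁))
    (hd₂ : d₂ = b₁ * d₄ - b₄ * d₁)
    (hd₃ : d₃ = b₂ * d₃ - b₃ * d₂)
    (hd₄ : d₄ = (b₂ * d₄ - b₄ * d₂) - (b₂ * d₃ - b₃ * d₂)) :
    (a₁ = 1 ∧ a₂ = 0 ∧ a₃ = 0 ∧ a₄ = 0) ∧ (b₁ = 0 ∧ b₂ = 1 ∧ b₃ = 0 ∧ b₄ = 0) ∧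
    (c₁ = 0 ∧ c₂ = 0 ∧ c₃ = 1 ∧ c₄ = 0) ∧ (d₁ = 0 ∧ d₂ = 0 ∧ d₃ = 0 ∧ d₄ = 1) := by
  -- The plane spanned by the first two basis vectors is preserved.
  obtain rfl : a₃ = 0 := (mul_eq_zero_iff_right ab₁₂).1
    (by linear_combination a₂ * ab₁₃ - a₁ * ab₂₃)
  obtain rfl : a₄ = 0 := (mul_eq_zero_iff_right ab₁₂).1
    (by linear_combination a₂ * ab₁₄ - a₁ * ab₂₄)
  obtain rfl : b₃ = 0 := (mul_eq_zero_iff_right ab₁₂).1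
    (by linear_combination b₂ * ab₁₃ - b₁ * ab₂₃)
  obtain rfl : b₄ = 0 := (mul_eq_zero_iff_right ab₁₂).1
    (by linear_combination b₂ * ab₁₄ - b₁ * ab₂₄)
  simp only [zero_mul, sub_zero, zero_add] at ab₁₂ ha₁ ha₂ ha₃ ha₄ hb₁ hb₂
  simp only [zero_mul, sub_zero] at hc₁ hc₂ hc₃ hc₄ hd₁ hd₂ hd₃ hd₄
  obtain rfl : a₂ = 0 := by
    by_contra h
    have h3 : c₃ = 0 := by simpa [h] using ha₃.symm
    have h4 : c₄ = 0 := by simpa [h, h3] using ha₄.symm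
    exact h (by rw [ha₂, h4, mul_zero])
  simp only [zero_mul, sub_zero] at ab₁₂ ha₁ ha₂ hc₄ hd₄
  have ha0 : a₁ ≠ 0 := left_ne_zero_of_mul ab₁₂
  have hb0 : b₂ ≠ 0 := right_ne_zero_of_mul ab₁₂
  obtain rfl : c₄ = 0 := by simpa [ha0] using ha₂.symm
  obtain rfl : c₃ = 1 := by
    apply mul_left_cancel₀ ha0
    linear_combination -ha₁
  have hd : d₄ = 1 + d₃ := by
    apply mul_left_cancel₀ hb0
    linear_combination -hc₄
  obtain rfl : d₃ = 0 := by
    have : (2 : F) * d₃ = 0 := by linear_combination hd₄ - hd + b₂ * hd - hc₃ + hd₃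
    simpa [h2] using this
  obtain rfl : d₄ = 1 := by rw [hd, add_zero]
  obtain rfl : b₂ = 1 := by linear_combination -hc₃
  obtain rfl : a₁ = 1 := by linear_combination -hb₂
  obtain rfl : b₁ = 0 := by linear_combination hb₁
  exact ⟨⟨rfl, rfl, rfl, rfl⟩, ⟨rfl, rfl, rfl, rfl⟩,
    ⟨by linear_combination hc₁, by linear_combination hc₂, rfl, rfl⟩,
    by linear_combination hd₁, by linear_combination hd₂, rfl, rfl⟩

namespace Model

variable {p : ℕ}

theorem commutator_a_b_zpow (i : ℤ) : ⁅a p, b p⁆ ^ i = ⟨0, 0, 0, 0, i, 0⟩ := by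
  simpa using word_eq (p := p) 0 0 0 0 i 0

theorem red_eq_zero_of_central (hp : p.Prime) {g : Model p} (hg : ∀ x : Model p, ⁅g, x⁆ = 1) :
    red p g.x₁ = 0 ∧ red p g.x₂ = 0 ∧ red p g.x₃ = 0 ∧ red p g.x₄ = 0 := by
  have ha := hg (a p)
  have hb := hg (b p)
  rw [commutator_eq, Model.ext_iff] at ha hb
  have h4 : red p g.x₄ = 0 := by
    simpa [a, ← mul_neg, p_mul_eq_zero_iff hp, -mul_neg] using ha.2.1
  have h3 : red p g.x₃ = 0 := by
    simpa [a, p_mul_eq_zero_iff hp, h4, -mul_neg] using ha.1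
  have h2 : red p g.x₂ = 0 := by simpa [a, h4] using ha.2.2.2.2.1
  have h1 : red p g.x₁ = 0 := by simpa [b] using hb.2.2.2.2.1
  exact ⟨h1, h2, h3, h4⟩

/-- Suppose that `α, β, γ, δ` satisfy the relations of `H`, with `p`-th powers twisted by powers of
`[a, b]`, and that `[α, β]` is a nontrivial power of `[a, b]`. Then `α, β, γ, δ` agree with the
generators `a, b, c, d` modulo the commutator subgroup, and the twists are trivial. -/
theorem rigid (hp : p.Prime) (hodd : p ≠ 2) {α β γ δ : Model p} {i j k l n : ℤ}
    (hα : α ^ p * ⁅a p, b p⁆ ^ i = ⁅α, γ⁆) (hβ : β ^ p * ⁅a p, b p⁆ ^ j = ⁅α, β * γ * δ⁆)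
    (hγ : γ ^ p * ⁅a p, b p⁆ ^ k = ⁅β, γ * δ⁆) (hδ : δ ^ p * ⁅a p, b p⁆ ^ l = ⁅β, δ⁆)
    (hαβ : ⁅α, β⁆ = ⁅a p, b p⁆ ^ n) (hne : ⁅α, β⁆ ≠ 1) :
    ((a p)⁻¹ * α ∈ commutator (Model p) ∧ (p : ℤ) ∣ i) ∧
    ((b p)⁻¹ * β ∈ commutator (Model p) ∧ (p : ℤ) ∣ j) ∧
    ((c p)⁻¹ * γ ∈ commutator (Model p) ∧ (p : ℤ) ∣ k) ∧
    ((d p)⁻¹ * δ ∈ commutator (Model p) ∧ (p : ℤ) ∣ l) ∧ (p : ℤ) ∣ n - 1 := by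
  have : Fact p.Prime := ⟨hp⟩
  have h2 : (2 : ZMod p) ≠ 0 := fun h => hodd <| by
    have h' : ((2 : ℕ) : ZMod p) = 0 := by exact_mod_cast h
    rw [ZMod.natCast_eq_zero_iff] at h'
    exact (Nat.prime_dvd_prime_iff_eq hp Nat.prime_two).1 h'
  rw [pow_p_eq hp hodd, commutator_a_b_zpow, commutator_eq, Model.ext_iff] at hα hβ hγ hδ
  rw [commutator_eq, ne_eq, Model.ext_iff] at hne
  rw [commutator_a_b_zpow, commutator_eq, Model.ext_iff] at hαβ
  simp only [mul_x₁, mul_x₂, mul_x₃, mul_x₄, mul_s, mul_zero, zero_mul, add_zero,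
    one_x₁, one_x₂, one_x₃, one_x₄, one_s, one_t,
    map_zero, sub_zero, zero_add, p_mul_inj hp, p_mul_eq_zero_iff hp, map_mul, map_sub,
    map_add, red_p] at hα hβ hγ hδ hαβ hne
  obtain ⟨ha₁, ha₂, ha₃, ha₄, has, -⟩ := hα
  obtain ⟨hb₁, hb₂, hb₃, hb₄, hbs, -⟩ := hβ
  obtain ⟨hc₁, hc₂, hc₃, hc₄, hcs, -⟩ := hγ
  obtain ⟨hd₁, hd₂, hd₃, hd₄, hds, -⟩ := hδ
  obtain ⟨e₁, e₂, e₃, e₄, es, et⟩ := hαβ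
  have e₁' := e₂ ▸ e₁
  have e₄' := e₃ ▸ e₄
  rw [sub_zero] at e₁' e₄'
  rw [e₁', e₂, e₃, e₄', et] at hne
  have h12 : red p α.x₁ * red p β.x₂ - red p α.x₂ * red p β.x₁ ≠ 0 := fun h => hne (by simp [h])
  obtain ⟨⟨A₁, A₂, A₃, A₄⟩, ⟨B₁, B₂, B₃, B₄⟩, ⟨C₁, C₂, C₃, C₄⟩, D₁, D₂, D₃, D₄⟩ :=
    eq_standard_basis_of_wedge_relations h2 h12 e₁' e₂ e₃ e₄' ha₁ ha₂ ha₃ ha₄ hb₁ hb₂ hc₁ hc₂ hc₃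
      hc₄ hd₁ hd₂ hd₃ hd₄
  rw [A₁, A₂, A₄] at has
  rw [A₁] at hbs
  simp only [← ZMod.intCast_zmod_eq_zero_iff_dvd]
  refine ⟨⟨?_, ?_⟩, ⟨?_, ?_⟩, ⟨?_, ?_⟩, ⟨?_, ?_⟩, ?_⟩
  · apply mem_commutator hp hodd <;> simp [a, A₁, A₂, A₃, A₄]
  · simpa [A₁, A₂, A₃, A₄, B₁, B₂, B₃, B₄, C₁, C₂, C₃, C₄, D₁, D₂, D₃, D₄] using has
  · apply mem_commutator hp hodd <;> simp [b, B₁, B₂, B₃, B₄]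
  · simpa [A₁, A₂, A₃, A₄, B₁, B₂, B₃, B₄, C₁, C₂, C₃, C₄, D₁, D₂, D₃, D₄] using hbs
  · apply mem_commutator hp hodd <;> simp [c, C₁, C₂, C₃, C₄]
  · simpa [A₁, A₂, A₃, A₄, B₁, B₂, B₃, B₄, C₁, C₂, C₃, C₄, D₁, D₂, D₃, D₄] using hcs
  · apply mem_commutator hp hodd <;> simp [d, D₁, D₂, D₃, D₄]
  · simpa [A₁, A₂, A₃, A₄, B₁, B₂, B₃, B₄, C₁, C₂, C₃, C₄, D₁, D₂, D₃, D₄] using hds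
  · rw [e₂, A₁, A₂, B₁, B₂] at es
    rw [Int.cast_sub, ← es]
    simp

end Model

/-! ### Automorphisms of the central products -/

namespace Model

variable {p : ℕ} {G : Type*} [Group G]

theorem mem_of_generators_mem (S : Subgroup (Model p)) (ha : a p ∈ S) (hb : b p ∈ S)
    (hc : c p ∈ S) (hd : d p ∈ S) (g : Model p) : g ∈ S := by
  have hcomm : ∀ x ∈ S, ∀ y ∈ S, ⁅x, y⁆ ∈ S := fun x hx y hy =>
    mul_mem (mul_mem (mul_mem hx hy) (inv_mem hx)) (inv_mem hy)
  obtain ⟨n₁, n₂, n₃, n₄, s, t, rfl⟩ := exists_word g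
  exact mul_mem (mul_mem (mul_mem (mul_mem (mul_mem (zpow_mem hd _) (zpow_mem hc _))
    (zpow_mem hb _)) (zpow_mem ha _)) (zpow_mem (hcomm _ ha _ hb) _)) (zpow_mem (hcomm _ hc _ hd) _)

/-- The universal property of the presentation of `H`, transported to the model. -/
theorem exists_hom (hp : p.Prime) (hodd : p ≠ 2) {L : Type*} [Group L]
    (h2 : ∀ x y z : L, ⁅⁅x, y⁆, z⁆ = 1) {a' b' c' d' : L}
    (ha : a' ^ p = ⁅a', c'⁆) (hb : b' ^ p = ⁅a', b' * c' * d'⁆) (hc : c' ^ p = ⁅b', c' * d'⁆)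
    (hd : d' ^ p = ⁅b', d'⁆) :
    ∃ f : Model p →* L, f (a p) = a' ∧ f (b p) = b' ∧ f (c p) = c' ∧ f (d p) = d' := by
  obtain ⟨θ, ha', hb', hc', hd'⟩ := GroupH.exists_equiv_model hp hodd
  obtain ⟨f, hfa, hfb, hfc, hfd⟩ := GroupH.exists_hom h2 ha hb hc hd
  refine ⟨f.comp θ.symm.toMonoidHom, ?_, ?_, ?_, ?_⟩
  · simp [← ha', hfa]
  · simp [← hb', hfb]
  · simp [← hc', hfc]
  · simp [← hd', hfd]

variable {m : Model p} {ι : Model p →* G} {z : G}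

theorem class_two_of_isCentralProductWith (hz : IsCentralProductWith p m ι z) (x y g : G) :
    ⁅⁅x, y⁆, g⁆ = 1 := by
  obtain ⟨h, i, rfl⟩ := hz.exists_eq x
  obtain ⟨k, j, rfl⟩ := hz.exists_eq y
  obtain ⟨l, n, rfl⟩ := hz.exists_eq g
  have := hz.commutator_eq ⁅h, k⁆ l 0 n
  rw [zpow_zero, mul_one] at this
  rw [hz.commutator_eq, this, commutator_commutator, map_one]

theorem mem_of_generators_mem_of_isCentralProductWith (hz : IsCentralProductWith p m ι z)
    (S : Subgroup G) (ha : ι (a p) ∈ S) (hb : ι (b p) ∈ S)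
    (hc : ι (c p) ∈ S) (hd : ι (d p) ∈ S) (hzS : z ∈ S) (g : G) : g ∈ S := by
  obtain ⟨h, n, rfl⟩ := hz.exists_eq g
  exact mul_mem (mem_of_generators_mem (S.comap ι) ha hb hc hd h) (zpow_mem hzS n)

/-- Amalgamation over `⟨[a, b]⟩` gives a Miller group: by `rigid`, every automorphism acts trivially
modulo the commutator subgroup. -/
theorem isMiller_of_isCentralProductWith (hp : p.Prime) (hodd : p ≠ 2)
    (hz : IsCentralProductWith p ⁅a p, b p⁆ ι z) : IsMiller G := by
  have : Fact p.Prime := ⟨hp⟩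
  have h2 := class_two_of_isCentralProductWith hz
  have hab : ι ⁅a p, b p⁆ ≠ 1 := by
    rw [ne_eq, map_eq_one_iff ι hz.injective, commutator_a_b]
    exact fun h => one_ne_zero (congrArg Model.s h)
  refine ⟨⟨ι (a p), ι (b p), fun h => hab ?_⟩, ?_⟩
  · rwa [map_commutatorElement, commutatorElement_eq_one_iff_mul_comm]
  have hcenter : commutator G ≤ Subgroup.center G := by
    rw [commutator_def, Subgroup.commutator_le]
    exact fun x _ y _ => Subgroup.mem_center_iff.2 fun g =>
      (commutatorElement_eq_one_iff_mul_comm.1 (h2 x y g)).symm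
  refine mulAut_mul_comm hcenter fun φ => ?_
  have hmap : ∀ h ∈ commutator (Model p), ι h ∈ commutator G := fun h hh => by
    have := Subgroup.mem_map_of_mem ι hh
    rw [commutator_def, Subgroup.map_commutator] at this
    exact Subgroup.commutator_mono le_top le_top this
  have hm : ⁅a p, b p⁆ ∈ commutator (Model p) :=
    Subgroup.commutator_mem_commutator (Subgroup.mem_top _) (Subgroup.mem_top _)
  -- Being congruent to its image modulo `G'` need only be checked on generators.
  let S : Subgroup G := MonoidHom.eqLocus (QuotientGroup.mk' (commutator G))
    ((QuotientGroup.mk' (commutator G)).comp φ.toMonoidHom)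
  have hS : ∀ g, g ∈ S ↔ g⁻¹ * φ g ∈ commutator G := fun g => QuotientGroup.eq
  have hSι : ∀ x y : Model p, ∀ i : ℤ, ι y * z ^ i = φ (ι x) → x⁻¹ * y ∈ commutator (Model p) →
      (p : ℤ) ∣ i → ι x ∈ S := by
    rintro x y _ hx hxy ⟨i, rfl⟩
    rw [hS, ← hx, hz.zpow_mul_eq, ← map_inv, ← mul_assoc, ← map_mul, ← map_mul]
    exact hmap _ (mul_mem hxy (zpow_mem hm _))
  obtain ⟨α, i, hα⟩ := hz.exists_eq (φ (ι (a p)))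
  obtain ⟨β, j, hβ⟩ := hz.exists_eq (φ (ι (b p)))
  obtain ⟨γ, k, hγ⟩ := hz.exists_eq (φ (ι (c p)))
  obtain ⟨δ, l, hδ⟩ := hz.exists_eq (φ (ι (d p)))
  obtain ⟨ζ, n, hζ⟩ := hz.exists_eq (φ z)
  have hαβ : ι ⁅α, β⁆ = φ (ι ⁅a p, b p⁆) := by
    rw [map_commutatorElement ι (a p), map_commutatorElement φ, ← hα, ← hβ, hz.commutator_eq]
  -- `φ z` is central, so its component `ζ` in the model is central.
  have hζc : ∀ x : Model p, ⁅ζ, x⁆ = 1 := by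
    intro x
    have h := hz.commutator_eq ζ x n 0
    rw [hζ, zpow_zero, mul_one] at h
    rw [← map_eq_one_iff ι hz.injective, ← h, commutatorElement_eq_one_iff_mul_comm,
      ← φ.apply_symm_apply (ι x), ← map_mul, ← map_mul,
      (hz.commute_of_forall (φ.symm (ι x))).eq]
  have hζred := red_eq_zero_of_central hp hζc
  have hζp : ζ ^ p = 1 := by
    rw [pow_p_eq hp hodd, (p_mul_eq_zero_iff hp _).2 hζred.1, (p_mul_eq_zero_iff hp _).2 hζred.2.1,
      (p_mul_eq_zero_iff hp _).2 hζred.2.2.1, (p_mul_eq_zero_iff hp _).2 hζred.2.2.2]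
    rfl
  have hn : ⁅α, β⁆ = ⁅a p, b p⁆ ^ n := by
    apply hz.injective
    rw [hαβ, ← hz.pow_eq, map_pow, ← hζ, hz.mul_zpow_pow, hζp, one_mul]
  have hne : ⁅α, β⁆ ≠ 1 := fun h => by
    rw [h, map_one, eq_comm, map_eq_one_iff φ φ.injective] at hαβ
    exact hab hαβ
  obtain ⟨⟨hα', hi⟩, ⟨hβ', hj⟩, ⟨hγ', hk⟩, ⟨hδ', hl⟩, r, hr⟩ :=
    rigid hp hodd (α := α) (β := β) (γ := γ)
    (δ := δ) (i := i) (j := j) (k := k) (l := l) (n := n)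
    (hz.injective <| by
      rw [← hz.mul_zpow_pow, hα, ← map_pow, ← map_pow, a_pow hp hodd, map_commutatorElement,
        map_commutatorElement, ← hα, ← hγ, hz.commutator_eq])
    (hz.injective <| by
      rw [← hz.mul_zpow_pow, hβ, ← map_pow, ← map_pow, b_pow hp hodd, map_commutatorElement,
        map_commutatorElement, map_mul, map_mul, map_mul, map_mul, ← hα, ← hβ, ← hγ, ← hδ,
        hz.mul_zpow_mul, hz.mul_zpow_mul, hz.commutator_eq])
    (hz.injective <| by
      rw [← hz.mul_zpow_pow, hγ, ← map_pow, ← map_pow, c_pow hp hodd, map_commutatorElement,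
        map_commutatorElement, map_mul, map_mul, ← hβ, ← hγ, ← hδ,
        hz.mul_zpow_mul, hz.commutator_eq])
    (hz.injective <| by
      rw [← hz.mul_zpow_pow, hδ, ← map_pow, ← map_pow, d_pow hp hodd, map_commutatorElement,
        map_commutatorElement, ← hβ, ← hδ, hz.commutator_eq]) hn hne
  have hzS : z ∈ S := by
    obtain rfl : n = p * r + 1 := by linarith
    rw [hS, ← hζ, zpow_add, zpow_one, hz.zpow_mul_eq, ← mul_assoc (ι ζ), ← map_mul,
      (hz.commute _).eq, inv_mul_cancel_left]
    exact hmap _ (mul_mem (mem_commutator hp hodd hζred.1 hζred.2.1 hζred.2.2.1 hζred.2.2.2)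
      (zpow_mem hm _))
  exact fun g => (hS g).1 <| mem_of_generators_mem_of_isCentralProductWith hz S
    (hSι _ _ _ hα hα' hi) (hSι _ _ _ hβ hβ' hj) (hSι _ _ _ hγ hγ' hk) (hSι _ _ _ hδ hδ' hl) hzS g

/-- Elements `ι α * z ^ i, ι β * z ^ j, ι γ, ι δ` that satisfy the relations of `a, b, c, d` in the
central product over `[a, d]`, and that generate it together with `z`, are the images of
`a, b, c, d` under an automorphism that fixes `z`. -/
theorem exists_mulAut (hp : p.Prime) (hodd : p ≠ 2) (hz : IsCentralProductWith p m ι z)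
    {α β γ δ : Model p} {i j : ℤ}
    (hα : α ^ p * m ^ i = ⁅α, γ⁆) (hβ : β ^ p * m ^ j = ⁅α, β * γ * δ⁆)
    (hγ : γ ^ p = ⁅β, γ * δ⁆) (hδ : δ ^ p = ⁅β, δ⁆) (hm : m = ⁅a p, d p⁆) (hαδ : ⁅α, δ⁆ = m)
    (hgen : ∀ S : Subgroup G, z ∈ S → ι α * z ^ i ∈ S → ι β * z ^ j ∈ S → ι γ ∈ S → ι δ ∈ S →
      ι (a p) ∈ S ∧ ι (b p) ∈ S ∧ ι (c p) ∈ S ∧ ι (d p) ∈ S) :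
    ∃ φ : MulAut G, φ (ι (a p)) = ι α * z ^ i ∧ φ (ι (b p)) = ι β * z ^ j ∧
      φ (ι (c p)) = ι γ ∧ φ (ι (d p)) = ι δ ∧ φ z = z := by
  have : Fact p.Prime := ⟨hp⟩
  have e : ∀ x, ι x = ι x * z ^ (0 : ℤ) := fun x => by rw [zpow_zero, mul_one]
  obtain ⟨f, ha, hb, hc, hd⟩ := exists_hom hp hodd (class_two_of_isCentralProductWith hz)
    (a' := ι α * z ^ i) (b' := ι β * z ^ j) (c' := ι γ) (d' := ι δ)
    (by rw [hz.mul_zpow_pow, hα, e γ, hz.commutator_eq])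
    (by rw [hz.mul_zpow_pow, hβ, e γ, e δ, hz.mul_zpow_mul, hz.mul_zpow_mul, hz.commutator_eq])
    (by rw [← map_pow, hγ, ← map_mul, e (γ * δ), hz.commutator_eq])
    (by rw [← map_pow, hδ, e δ, hz.commutator_eq])
  obtain ⟨F, hF, hFz⟩ := hz.exists_hom f (fun h => hz.commute_of_forall (f h)) (by
    rw [hz.pow_eq]
    conv_rhs => rw [hm, map_commutatorElement, ha, hd, e δ, hz.commutator_eq, hαδ])
  rw [← hF] at ha hb hc hd
  have : Finite G := by
    have : Finite (Model p) := Finite.of_equiv _ (equivProd p).symm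
    exact hz.finite hp
  have hsurj : Function.Surjective F := by
    obtain ⟨h₁, h₂, h₃, h₄⟩ := hgen F.range ⟨z, hFz⟩ ⟨_, ha⟩ ⟨_, hb⟩ ⟨_, hc⟩ ⟨_, hd⟩
    exact mem_of_generators_mem_of_isCentralProductWith hz F.range h₁ h₂ h₃ h₄ ⟨z, hFz⟩
  exact ⟨MulEquiv.ofBijective F (Finite.injective_iff_bijective.1
    (Finite.injective_iff_surjective.2 hsurj)), ha, hb, hc, hd, hFz⟩

/-- Amalgamation over `⟨[a, d]⟩` does not give a Miller group: the automorphism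
`a ↦ a z`, `b ↦ b z`, `c ↦ c d`, `d ↦ d`, `z ↦ z` does not commute with the one that sends `d` to
`d [a, d]` and fixes `a, b, c, z`; the composites differ on `c`. -/
theorem not_isMiller_of_isCentralProductWith (hp : p.Prime) (hodd : p ≠ 2)
    (hz : IsCentralProductWith p ⁅a p, d p⁆ ι z) : ¬ IsMiller G := by
  have : Fact p.Prime := ⟨hp⟩
  rintro ⟨-, hcomm⟩
  obtain ⟨φ, -, -, hφc, hφd, hφz⟩ := exists_mulAut hp hodd hz
    (α := a p) (β := b p) (γ := c p * d p) (δ := d p) (i := 1) (j := 1)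
    (by rw [zpow_one, commutator_a_d, pow_p_eq hp hodd, commutator_eq]
        ext <;> simp [a, c, d])
    (by rw [zpow_one, commutator_a_d, pow_p_eq hp hodd, commutator_eq]
        ext <;> simp [a, b, c, d]; linear_combination -p_mul_p (p := p))
    (by rw [pow_p_eq hp hodd, commutator_eq]; ext <;> simp [b, c, d])
    (d_pow hp hodd) rfl rfl
    (fun S hzS ha hb hc hd => ⟨(S.mul_mem_cancel_right (zpow_mem hzS _)).1 ha,
      (S.mul_mem_cancel_right (zpow_mem hzS _)).1 hb,
      (S.mul_mem_cancel_right hd).1 (map_mul ι (c p) (d p) ▸ hc), hd⟩)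
  obtain ⟨ψ, -, -, hψc, hψd, hψz⟩ := exists_mulAut hp hodd hz
    (α := a p) (β := b p) (γ := c p) (δ := d p * ⁅a p, d p⁆) (i := 0) (j := 0)
    (by rw [zpow_zero, mul_one, a_pow hp hodd])
    (by rw [zpow_zero, mul_one, commutator_a_d, pow_p_eq hp hodd, commutator_eq]
        ext <;> simp [a, b, c, d, p_mul_p])
    (by rw [commutator_a_d, pow_p_eq hp hodd, commutator_eq]
        ext <;> simp [b, c, d])
    (by rw [commutator_a_d, pow_p_eq hp hodd, commutator_eq]
        ext <;> simp [b, d, p_mul_p])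
    rfl
    (by rw [commutator_a_d, commutator_eq]; ext <;> simp [a, d])
    (fun S hzS ha hb hc hd => by
      rw [zpow_zero, mul_one] at ha hb
      rw [map_mul, ← hz.pow_eq] at hd
      exact ⟨ha, hb, hc, (S.mul_mem_cancel_right (pow_mem hzS _)).1 hd⟩)
  have h := DFunLike.congr_fun (hcomm φ ψ) (ι (c p))
  rw [MulAut.mul_apply, MulAut.mul_apply, hψc, hφc, map_mul, map_mul, hψc, hψd, map_mul,
    mul_right_inj, left_eq_mul, map_eq_one_iff ι hz.injective, commutator_a_d] at h
  exact neg_ne_zero.2 one_ne_zero (congrArg Model.s h)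

end Model

/-- In the model, `p`-th powers have vanishing coordinate `s`, so this coordinate detects elements
outside `H ^ p`. -/
theorem GroupH.isAmalgamationSubgroup_of_model {p : ℕ} (hp : p.Prime) (hodd : p ≠ 2)
    (θ : GroupH p ≃* Model p) {m : GroupH p} (hm : m ∈ commutator (GroupH p))
    (hpow : θ m ^ p = 1) (hs : (θ m).s ≠ 0) :
    IsAmalgamationSubgroup p (Subgroup.zpowers m) := by
  have : Fact p.Prime := ⟨hp⟩
  refine ⟨by rwa [Subgroup.zpowers_le], ?_, fun h => hs ?_⟩
  · rw [Nat.card_zpowers]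
    refine orderOf_eq_prime ?_ ?_
    · rwa [← map_eq_one_iff θ θ.injective, map_pow]
    · rintro rfl
      exact hs (by rw [map_one, Model.one_s])
  · have key : ∀ x ∈ powerSubgroup p (GroupH p), Model.red p (θ x).x₁ = 0 ∧ (θ x).s = 0 := by
      intro x hx
      induction hx using Subgroup.closure_induction with
      | mem x hx =>
        obtain ⟨g, rfl⟩ := hx
        rw [map_pow, Model.pow_p_eq hp hodd]
        simp
      | one => simp
      | mul x y _ _ hx hy => simp [hx.1, hx.2, hy.1, hy.2]
      | inv x _ hx => simp [hx.1, hx.2]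
    exact (key m (h (Subgroup.mem_zpowers m))).2

theorem theoremA (p : ℕ) (hp : p.Prime) (hodd : p ≠ 2) :
    Nat.card (GroupH p) = p ^ 10 ∧
    IsAmalgamationSubgroup p (Subgroup.zpowers ⁅GroupH.a p, GroupH.b p⁆) ∧
    IsAmalgamationSubgroup p (Subgroup.zpowers ⁅GroupH.a p, GroupH.d p⁆) ∧
    ∀ M : Subgroup (GroupH p), IsAmalgamationSubgroup p M →
      (∃ (G : Type) (_ : Group G) (ι : GroupH p →* G) (z : G), IsGroupG₁ p M ι z) ∧
      ∀ (G : Type*) [Group G] (ι : GroupH p →* G) (z : G), IsGroupG₁ p M ι z →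
        Finite G ∧ IsPGroup p G ∧ ¬ IsSpecial p G ∧
        (M = Subgroup.zpowers ⁅GroupH.a p, GroupH.b p⁆ → IsMiller G) ∧
        (M = Subgroup.zpowers ⁅GroupH.a p, GroupH.d p⁆ → ¬ IsMiller G) := by
  have : Fact p.Prime := ⟨hp⟩
  obtain ⟨θ, ha, hb, -, hd⟩ := GroupH.exists_equiv_model hp hodd
  have hcard : Nat.card (GroupH p) = p ^ 10 := by
    rw [Nat.card_congr θ.toEquiv, Model.card_eq]
  have hθab : θ ⁅GroupH.a p, GroupH.b p⁆ = ⁅Model.a p, Model.b p⁆ := by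
    rw [map_commutatorElement, ha, hb]
  have hθad : θ ⁅GroupH.a p, GroupH.d p⁆ = ⁅Model.a p, Model.d p⁆ := by
    rw [map_commutatorElement, ha, hd]
  have hmem : ∀ x y : GroupH p, ⁅x, y⁆ ∈ commutator (GroupH p) := fun x y =>
    Subgroup.commutator_mem_commutator (Subgroup.mem_top x) (Subgroup.mem_top y)
  have hab : IsAmalgamationSubgroup p (Subgroup.zpowers ⁅GroupH.a p, GroupH.b p⁆) := by
    refine GroupH.isAmalgamationSubgroup_of_model hp hodd θ (hmem _ _) ?_ ?_
    · rw [hθab, Model.commutator_a_b, Model.pow_p_eq hp hodd]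
      ext <;> simp
    · rw [hθab, Model.commutator_a_b]
      exact one_ne_zero
  have had : IsAmalgamationSubgroup p (Subgroup.zpowers ⁅GroupH.a p, GroupH.d p⁆) := by
    refine GroupH.isAmalgamationSubgroup_of_model hp hodd θ (hmem _ _) ?_ ?_
    · rw [hθad, Model.commutator_a_d, Model.pow_p_eq hp hodd]
      ext <;> simp [Model.p_mul_p]
    · rw [hθad, Model.commutator_a_d]
      exact neg_ne_zero.2 one_ne_zero
  refine ⟨hcard, hab, had, fun M hM => ?_⟩
  have hcyclic : IsCyclic M := isCyclic_of_prime_card hM.card_eq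
  obtain ⟨m, rfl⟩ := M.isCyclic_iff_exists_zpowers_eq_top.1 hcyclic
  have horder : ∀ m' : GroupH p, Subgroup.zpowers m = Subgroup.zpowers m' → orderOf m' = p :=
    fun m' h => by rw [← Nat.card_zpowers, ← h, hM.card_eq]
  have hcenter : commutator (GroupH p) ≤ Subgroup.center (GroupH p) := by
    rw [commutator_def, Subgroup.commutator_le]
    exact fun x _ y _ => Subgroup.mem_center_iff.2 fun g =>
      (commutator_mul_comm_of_class_two GroupH.commutator_commutator x y g).symm
  refine ⟨exists_isGroupG₁ hp (horder m rfl) fun h =>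
    (Subgroup.mem_center_iff.1 (hcenter (hM.le_commutator (Subgroup.mem_zpowers m))) h).symm, ?_⟩
  intro G _ ι z hG
  have hfin : Finite (GroupH p) := Nat.finite_of_card_ne_zero (by
    rw [hcard]; exact pow_ne_zero _ hp.ne_zero)
  obtain ⟨z', hz'⟩ := hG.exists_isCentralProductWith hp (horder m rfl) rfl
  refine ⟨hz'.finite hp, hz'.isPGroup (IsPGroup.of_card hcard), hz'.not_isSpecial hp, fun h => ?_,
    fun h => ?_⟩
  · obtain ⟨w, hw⟩ := hG.exists_isCentralProductWith hp (horder _ h) h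
    have hw' := hw.comp_symm θ
    rw [hθab] at hw'
    exact Model.isMiller_of_isCentralProductWith hp hodd hw'
  · obtain ⟨w, hw⟩ := hG.exists_isCentralProductWith hp (horder _ h) h
    have hw' := hw.comp_symm θ
    rw [hθad] at hw'
    exact Model.not_isMiller_of_isCentralProductWith hp hodd hw'
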